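/- Let $\bar M$ be a smooth $n$-dimensional manifold with boundary, with $n$ odd, and let $g$ be a smooth Riemannian metric on its interior $M$. A defining function is a smooth function $x$ on $\bar M$ that is positive on $M$ and has $x=0$, $dx\neq 0$ on $\partial\bar M$. It is a special defining function of $g$ if $x^2g$ extends to a smooth Riemannian metric on $\bar M$ and $|dx|_{x^2g}=1$ on a neighbourhood of $\partial\bar M$. We say that $g$ is in normal form with respect to $x$, inducing $h_x$, if a neighbourhood of $\partial \bar M$ is identified by a diffeomorphism, whose first component is $x$ and which sends $q\in\partial\bar M$ to $(0,q)$, with a relatively open neighbourhood of $\{0\}\times\partial\bar M$ in $[0,\infty)\times\partial\bar M$, in such a way that $$g=x^{-2}\left(dx^2\oplus h_x\right)$$ on the part of this neighbourhood that lies in $M$, where $h_x$ is a family of Riemannian metrics on $\partial\bar M$ that is smooth up to $x=0$. Then $g$ is called partially even in $x$ if, as $x\to0^+$, $$h_x=h_0+x^2h_{(2)}+\dots+x^{n-1}h_{(n-1)}+\tfrac1n\,\kappa\, x^n+\mathcal O(x^{n+1}),$$ with no term of odd order less than $n-1$; in that case $\mu:=\operatorname{tr}_{h_0}\kappa$ is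 called the mass aspect function. Proposition 2.6. Let $x$ and $\hat x$ be special defining functions of $g$, inducing $h_x$ and $\hat h_{\hat x}$ respectively, and let $g$ be partially even in $x$. Then $g$ is partially even in $\hat x$. If moreover $\omega_0$ is a function on $\partial\bar M$ with $\hat h_0=e^{2\omega_0}h_0$, then the mass aspect functions $\mu=\operatorname{tr}_{h_0}\kappa$ and $\hat\mu=\operatorname{tr}_{\hat h_0}\hat\kappa$ satisfy $$\hat\mu=e^{-n\omega_0}\mu .$$ -/

import Mathlib

open Set Topology Asymptotics Bundle Manifold
open scoped ContDiff

noncomputable section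

namespace AsympHyp

/-- A Riemannian metric on the interior of a manifold with boundary `M` of dimension `n`.
The values of `inner` at boundary points carry no information. -/
structure InteriorMetric (n : ℕ) [NeZero n] (M : Type*) [TopologicalSpace M]
    [ChartedSpace (EuclideanHalfSpace n) M] [IsManifold (𝓡∂ n) ∞ M] where
  /-- The scalar product on each tangent space. -/
  inner (p : M) : TangentSpace (𝓡∂ n) p →L[ℝ] TangentSpace (𝓡∂ n) p →L[ℝ] ℝ
  symm : ∀ p ∈ (𝓡∂ n).interior M, ∀ v w : TangentSpace (𝓡∂ n) p, inner p v w = inner p w v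
  pos : ∀ p ∈ (𝓡∂ n).interior M, ∀ v : TangentSpace (𝓡∂ n) p, v ≠ 0 → 0 < inner p v v
  smooth : ContMDiffOn (𝓡∂ n)
    ((𝓡∂ n).prod 𝓘(ℝ, EuclideanSpace ℝ (Fin n) →L[ℝ] EuclideanSpace ℝ (Fin n) →L[ℝ] ℝ)) ∞
    (fun p ↦ TotalSpace.mk' (EuclideanSpace ℝ (Fin n) →L[ℝ] EuclideanSpace ℝ (Fin n) →L[ℝ] ℝ)
      p (inner p)) ((𝓡∂ n).interior M)

section

variable {n : ℕ} [NeZero n] {M : Type*} [TopologicalSpace M]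
  [ChartedSpace (EuclideanHalfSpace n) M] [IsManifold (𝓡∂ n) ∞ M]

/-- The differential of a real function `x` at `p`, applied to the tangent vector `v`. -/
def diff (x : M → ℝ) (p : M) (v : TangentSpace (𝓡∂ n) p) : ℝ :=
  mfderiv (𝓡∂ n) 𝓘(ℝ, ℝ) x p v

/-- A defining function of the boundary: smooth up to the boundary, positive in the interior,
zero on the boundary, with nonvanishing differential there. -/
structure IsDefiningFunction (n : ℕ) [NeZero n] {M : Type*} [TopologicalSpace M]
    [ChartedSpace (EuclideanHalfSpace n) M] (x : M → ℝ) : Prop where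
  smooth : ContMDiff (𝓡∂ n) 𝓘(ℝ, ℝ) ∞ x
  pos : ∀ p ∈ (𝓡∂ n).interior M, 0 < x p
  zero : ∀ p ∈ (𝓡∂ n).boundary M, x p = 0
  diff_ne_zero : ∀ p ∈ (𝓡∂ n).boundary M, ∃ v : TangentSpace (𝓡∂ n) p, diff x p v ≠ 0

/-- `x` is a special defining function of `g`: the metric `x² g` extends to a smooth Riemannian
metric `gbar` up to the boundary, and `|dx| = 1` with respect to `gbar` on a neighbourhood of the
boundary. The norm condition says that the gradient `ν` of `x` exists (as it always does)
and has `dx ν = |dx|² = 1`. -/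
structure IsSpecialDefiningFunction (g : InteriorMetric n M) (x : M → ℝ) : Prop where
  isDefiningFunction : IsDefiningFunction n x
  exists_compactification :
    ∃ gbar : ContMDiffRiemannianMetric (𝓡∂ n) ∞ (EuclideanSpace ℝ (Fin n))
        (fun p : M ↦ TangentSpace (𝓡∂ n) p),
      (∀ p ∈ (𝓡∂ n).interior M, ∀ v w : TangentSpace (𝓡∂ n) p,
        gbar.inner p v w = x p ^ 2 * g.inner p v w) ∧
      ∃ U : Set M, IsOpen U ∧ (𝓡∂ n).boundary M ⊆ U ∧
        ∀ p ∈ U, ∃ ν : TangentSpace (𝓡∂ n) p,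
          (∀ v : TangentSpace (𝓡∂ n) p, gbar.inner p ν v = diff x p v) ∧ diff x p ν = 1

variable {N : Type*} [TopologicalSpace N] [ChartedSpace (EuclideanSpace ℝ (Fin (n - 1))) N]
  [IsManifold (𝓡 (n - 1)) ∞ N]

/-- `ι : N → M` identifies the `(n-1)`-manifold `N` with the boundary of `M`. -/
structure IsBoundaryInclusion (n : ℕ) [NeZero n] {M : Type*} [TopologicalSpace M]
    [ChartedSpace (EuclideanHalfSpace n) M] {N : Type*} [TopologicalSpace N]
    [ChartedSpace (EuclideanSpace ℝ (Fin (n - 1))) N] (ι : N → M) : Prop where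
  isSmoothEmbedding : IsSmoothEmbedding (𝓡 (n - 1)) (𝓡∂ n) ∞ ι
  range_eq : range ι = (𝓡∂ n).boundary M

/-- Normal form `g = x⁻² (dx² ⊕ h_x)` near the boundary. A neighbourhood `source` of the boundary
is identified by `p ↦ (x p, proj p)`, a diffeomorphism with inverse `collar`, with a relatively
open neighbourhood `domain` of `{0} × N` in `[0, ∞) × N`, the boundary `N` being identified with
`{0} × N`; and `h` is a smooth family `h_t` (up to `t = 0`) of Riemannian metrics on `N`. -/
structure NormalForm (g : InteriorMetric n M) (ι : N → M) (x : M → ℝ) where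
  /-- A neighbourhood of the boundary. -/
  source : Set M
  isOpen_source : IsOpen source
  boundary_subset : (𝓡∂ n).boundary M ⊆ source
  /-- The corresponding neighbourhood of `{0} × N` in `[0, ∞) × N`. -/
  domain : Set (ℝ × N)
  domain_eq : ∃ O : Set (ℝ × N), IsOpen O ∧ domain = O ∩ {z | 0 ≤ z.1}
  /-- The projection to the boundary. -/
  proj : M → N
  /-- The inverse of `p ↦ (x p, proj p)`. -/
  collar : ℝ × N → M
  proj_smooth : ContMDiffOn (𝓡∂ n) (𝓡 (n - 1)) ∞ proj source
  collar_smooth : ContMDiffOn (𝓘(ℝ, ℝ).prod (𝓡 (n - 1))) (𝓡∂ n) ∞ collar domain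
  mapsTo : ∀ p ∈ source, (x p, proj p) ∈ domain
  mapsTo_collar : ∀ z ∈ domain, collar z ∈ source
  left_inv : ∀ p ∈ source, collar (x p, proj p) = p
  right_inv : ∀ z ∈ domain, (x (collar z), proj (collar z)) = z
  proj_boundary : ∀ q, proj (ι q) = q
  /-- The family of metrics on the boundary. -/
  h : ℝ → ∀ q : N, TangentSpace (𝓡 (n - 1)) q →L[ℝ] TangentSpace (𝓡 (n - 1)) q →L[ℝ] ℝ
  h_symm : ∀ z ∈ domain, ∀ v w : TangentSpace (𝓡 (n - 1)) z.2, h z.1 z.2 v w = h z.1 z.2 w v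
  h_pos : ∀ z ∈ domain, ∀ v : TangentSpace (𝓡 (n - 1)) z.2, v ≠ 0 → 0 < h z.1 z.2 v v
  h_smooth : ContMDiffOn (𝓘(ℝ, ℝ).prod (𝓡 (n - 1)))
    ((𝓡 (n - 1)).prod 𝓘(ℝ, EuclideanSpace ℝ (Fin (n - 1)) →L[ℝ]
      EuclideanSpace ℝ (Fin (n - 1)) →L[ℝ] ℝ)) ∞
    (fun z : ℝ × N ↦ (TotalSpace.mk z.2 (h z.1 z.2) :
      TotalSpace (EuclideanSpace ℝ (Fin (n - 1)) →L[ℝ] EuclideanSpace ℝ (Fin (n - 1)) →L[ℝ] ℝ)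
        fun q : N ↦ TangentSpace (𝓡 (n - 1)) q →L[ℝ] TangentSpace (𝓡 (n - 1)) q →L[ℝ] ℝ)) domain
  metric_eq : ∀ p ∈ source ∩ (𝓡∂ n).interior M, ∀ v w : TangentSpace (𝓡∂ n) p,
    g.inner p v w = (x p ^ 2)⁻¹ * (diff x p v * diff x p w +
      h (x p) (proj p) (mfderiv (𝓡∂ n) (𝓡 (n - 1)) proj p v)
        (mfderiv (𝓡∂ n) (𝓡 (n - 1)) proj p w))

/-- The expansion `h_t = c₀ + t² c₂ + ⋯ + tⁿ⁻¹ cₙ₋₁ + tⁿ κ / n + O(tⁿ⁺¹)` as `t → 0⁺`, with no term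
of odd order less than `n - 1`. As `h` is smooth up to `t = 0`, it is enough to state it
pointwise. -/
def NormalForm.HasPartiallyEvenExpansion {g : InteriorMetric n M} {ι : N → M} {x : M → ℝ}
    (S : NormalForm g ι x)
    (κ : ∀ q : N, TangentSpace (𝓡 (n - 1)) q →L[ℝ] TangentSpace (𝓡 (n - 1)) q →L[ℝ] ℝ) : Prop :=
  ∃ c : ℕ → ∀ q : N, TangentSpace (𝓡 (n - 1)) q →L[ℝ] TangentSpace (𝓡 (n - 1)) q →L[ℝ] ℝ,
    (∀ k, Odd k → k + 1 < n → ∀ q, c k q = 0) ∧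
    (∀ q, κ q = (n : ℝ) • c n q) ∧
    ∀ (q : N) (v w : TangentSpace (𝓡 (n - 1)) q),
      (fun t : ℝ ↦ S.h t q v w - ∑ k ∈ Finset.range (n + 1), t ^ k * c k q v w)
        =O[𝓝[≥] 0] fun t : ℝ ↦ t ^ (n + 1)

/-- The metric, in normal form with respect to `x`, is partially even in `x`. -/
def NormalForm.IsPartiallyEven {g : InteriorMetric n M} {ι : N → M} {x : M → ℝ}
    (S : NormalForm g ι x) : Prop :=
  ∃ κ, S.HasPartiallyEvenExpansion κ

end

/-- The trace `B^{ij} K_{ij}` of a bilinear form `K` with respect to a scalar product `B` on a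
tangent space of `N`, in the standard basis of that space
(the result does not depend on the basis). -/
def metricTrace {m : ℕ} {N : Type*} [TopologicalSpace N]
    [ChartedSpace (EuclideanSpace ℝ (Fin m)) N] {q : N}
    (B K : TangentSpace (𝓡 m) q →L[ℝ] TangentSpace (𝓡 m) q →L[ℝ] ℝ) : ℝ :=
  let e : Fin m → TangentSpace (𝓡 m) q := fun i ↦ EuclideanSpace.single i (1 : ℝ)
  ((Matrix.of fun i j ↦ B (e i) (e j))⁻¹ * Matrix.of fun i j ↦ K (e i) (e j)).trace

section

variable {n : ℕ} [NeZero n] {M : Type*} [TopologicalSpace M]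
  [ChartedSpace (EuclideanHalfSpace n) M] [IsManifold (𝓡∂ n) ∞ M]
  {N : Type*} [TopologicalSpace N] [ChartedSpace (EuclideanSpace ℝ (Fin (n - 1))) N]
  [IsManifold (𝓡 (n - 1)) ∞ N]

/-- The mass aspect function `μ = tr_{h₀} κ` on the boundary. -/
def NormalForm.massAspect {g : InteriorMetric n M} {ι : N → M} {x : M → ℝ}
    (S : NormalForm g ι x)
    (κ : ∀ q : N, TangentSpace (𝓡 (n - 1)) q →L[ℝ] TangentSpace (𝓡 (n - 1)) q →L[ℝ] ℝ)
    (q : N) : ℝ :=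
  metricTrace (S.h 0 q) (κ q)

end

end AsympHyp

end

/-! Near a boundary point, write the collar coordinates of the first normal form as functions of
those of the second: `x = u(t, w) = t V(t, w)` and `y = z(t, w)`, with `z(0, w) = w`. Equating the
two expressions of `g` gives `u² (dt² + h'_t) = t² (du² + h_u(dz, dz))`. Everything is read off from
the Taylor series in `t`, with `w` as a parameter.

The key claim (`CoordChange.parity`) is that `V` and `z` have no odd coefficients of order at most
`n`. This goes by recursion over odd orders `k ≤ n`. If `V` and `z` have no odd coefficients below
`k`, then neither does the composite `h_u(z)`, because `h` itself has none below `n`. The mixed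
components of the identity at order `k - 1` then reduce to `h₀` applied to `k` times the `k`-th
coefficient of `z`, so that coefficient vanishes by nondegeneracy. With `z` improved, the `dt²`
component reduces to `2 V(0)` times `k` times the `k`-th coefficient of `V`, and `V(0) ≠ 0`.

Once `V`, `z` and their tangential derivatives have the right parity, the only odd contribution
through order `n` to the tangential components is the order-`n` coefficient of `h` itself, carried
by `u ^ n` (`exists_expTo_comp_collar`). With `α = V(0) > 0` this yields `α² h'₀ = h₀` and `α² κ' =
αⁿ κ` (`CoordChange.coeff_transform`). If `h'₀ = e^{2ω₀} h₀`, then `α = e^{-ω₀}`; the trace with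
respect to `h'₀` contributes `α²`, which leaves `μ' = αⁿ μ`. -/

noncomputable section

/-! ### One-sided asymptotic expansions, encoded by formal power series -/

namespace AsympHyp

open PowerSeries in
/-- The function `f` has the one-sided expansion `∑ j < K, p j * t ^ j + O(t ^ K)` at `0`. -/
def ExpTo (K : ℕ) (f : ℝ → ℝ) (p : PowerSeries ℝ) : Prop :=
  (fun t : ℝ ↦ f t - ∑ j ∈ Finset.range K, t ^ j * coeff j p) =O[𝓝[≥] 0] fun t : ℝ ↦ t ^ K

namespace ExpTo

open PowerSeries Filter

lemma pow_isBigO_pow {i j : ℕ} (h : i ≤ j) :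
    (fun t : ℝ ↦ t ^ j) =O[𝓝[≥] 0] fun t : ℝ ↦ t ^ i := by
  refine IsBigO.of_bound 1 ?_
  have : ∀ᶠ t : ℝ in 𝓝[≥] 0, t < 1 := nhdsWithin_le_nhds (eventually_lt_nhds one_pos)
  filter_upwards [this, self_mem_nhdsWithin] with t h1 h0
  have h0 : 0 ≤ t := h0
  rw [Real.norm_eq_abs, Real.norm_eq_abs, abs_of_nonneg (by positivity),
    abs_of_nonneg (by positivity), one_mul]
  exact pow_le_pow_of_le_one h0 h1.le h

variable {K : ℕ} {f g : ℝ → ℝ} {p q : PowerSeries ℝ}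

lemma mono (h : ExpTo K f p) {L : ℕ} (hL : L ≤ K) : ExpTo L f p := by
  have h1 : (fun t : ℝ ↦ ∑ j ∈ Finset.Ico L K, t ^ j * coeff j p) =O[𝓝[≥] 0]
      fun t : ℝ ↦ t ^ L := by
    refine IsBigO.fun_sum fun j hj ↦ ?_
    simp only [mul_comm _ (coeff j p)]
    exact (pow_isBigO_pow (Finset.mem_Ico.1 hj).1).const_mul_left _
  refine ((h.trans (pow_isBigO_pow hL)).add h1).congr_left fun t ↦ ?_
  rw [← Finset.sum_range_add_sum_Ico _ hL]; ring

lemma congr_fun (h : ExpTo K f p) (hfg : f =ᶠ[𝓝[≥] 0] g) : ExpTo K g p := by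
  refine IsBigO.congr' h ?_ EventuallyEq.rfl
  filter_upwards [hfg] with t ht
  rw [ht]

lemma congr_coeff (h : ExpTo K f p) (hpq : ∀ j < K, coeff j p = coeff j q) : ExpTo K f q := by
  refine IsBigO.congr_left h fun t ↦ ?_
  rw [Finset.sum_congr rfl fun j hj ↦ by rw [hpq j (Finset.mem_range.1 hj)]]

lemma congr_isBigO (h : ExpTo K f p) (hfg : (fun t ↦ g t - f t) =O[𝓝[≥] 0] fun t : ℝ ↦ t ^ K) :
    ExpTo K g p :=
  (IsBigO.add hfg h).congr_left fun t ↦ by ring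

lemma isBigO_sub (hf : ExpTo K f p) (hg : ExpTo K g q) (hpq : ∀ j < K, coeff j p = coeff j q) :
    (fun t ↦ f t - g t) =O[𝓝[≥] 0] fun t : ℝ ↦ t ^ K :=
  (IsBigO.sub (hf.congr_coeff hpq) hg).congr_left fun t ↦ by ring

lemma add (hf : ExpTo K f p) (hg : ExpTo K g q) : ExpTo K (fun t ↦ f t + g t) (p + q) := by
  refine (IsBigO.add hf hg).congr_left fun t ↦ ?_
  simp only [map_add, mul_add, Finset.sum_add_distrib]; ring

lemma const_mul (c : ℝ) (hf : ExpTo K f p) : ExpTo K (fun t ↦ c * f t) (C c * p) := by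
  refine (IsBigO.const_mul_left hf c).congr_left fun t ↦ ?_
  simp only [coeff_C_mul, mul_sub, Finset.mul_sum]
  congr 1
  exact Finset.sum_congr rfl fun j _ ↦ by ring

lemma of_isBigO (hf : f =O[𝓝[≥] 0] fun t : ℝ ↦ t ^ K) : ExpTo K f 0 := by
  simpa [ExpTo] using hf

lemma zero : ExpTo K (fun _ ↦ 0) 0 := of_isBigO (isBigO_zero _ _)

lemma sum {ι : Type*} (s : Finset ι) {f : ι → ℝ → ℝ} {p : ι → PowerSeries ℝ}
    (h : ∀ i ∈ s, ExpTo K (f i) (p i)) : ExpTo K (fun t ↦ ∑ i ∈ s, f i t) (∑ i ∈ s, p i) := by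
  classical
  induction s using Finset.induction_on with
  | empty => simpa using zero
  | insert i s hi ih =>
    simp only [Finset.sum_insert hi]
    exact (h i (Finset.mem_insert_self _ _)).add
      (ih fun j hj ↦ h j (Finset.mem_insert_of_mem hj))

lemma polynomial (P : Polynomial ℝ) : ExpTo K (fun t ↦ P.eval t) (P : PowerSeries ℝ) := by
  have h : ∀ t : ℝ, P.eval t = ∑ j ∈ Finset.range (max K (P.natDegree + 1)), t ^ j * P.coeff j :=
    fun t ↦ by
      rw [Polynomial.eval_eq_sum_range' (lt_of_lt_of_le (Nat.lt_succ_self _) (le_max_right _ _))]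
      exact Finset.sum_congr rfl fun j _ ↦ mul_comm _ _
  refine ExpTo.mono (K := max K (P.natDegree + 1)) ?_ (le_max_left _ _)
  simp only [ExpTo, h, Polynomial.coeff_coe, sub_self]
  exact isBigO_zero _ _

lemma const (c : ℝ) : ExpTo K (fun _ ↦ c) (C c) := by
  simpa using polynomial (K := K) (Polynomial.C c)

lemma id : ExpTo K (fun t ↦ t) X := by
  simpa using polynomial (K := K) Polynomial.X

lemma isBigO_one_of_polynomial (P : Polynomial ℝ) :
    (fun t : ℝ ↦ P.eval t) =O[𝓝[≥] 0] fun _ ↦ (1 : ℝ) :=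
  (P.continuous.tendsto 0).isBigO_one ℝ |>.mono nhdsWithin_le_nhds

lemma sub_trunc (hf : ExpTo K f p) :
    (fun t ↦ f t - (trunc K p).eval t) =O[𝓝[≥] 0] fun t : ℝ ↦ t ^ K :=
  hf.isBigO_sub (polynomial _) fun j hj ↦ by simp [coeff_trunc, hj]

/-- The product of the truncations is a polynomial and needs no estimate; each truncation error is
multiplied by a bounded factor. Coefficients below `K` see only the truncations. -/
lemma mul (hf : ExpTo K f p) (hg : ExpTo K g q) : ExpTo K (fun t ↦ f t * g t) (p * q) := by
  have h1 := polynomial (K := K) (trunc K p * trunc K q)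
  have hg1 : g =O[𝓝[≥] 0] fun _ ↦ (1 : ℝ) := by
    have := (hg.sub_trunc.trans (pow_isBigO_pow (Nat.zero_le K)))
    simp only [pow_zero] at this
    exact (this.add (isBigO_one_of_polynomial (trunc K q))).congr_left fun t ↦ by ring
  have h2a := hf.sub_trunc.mul hg1
  have h2b := (isBigO_one_of_polynomial (trunc K p)).mul hg.sub_trunc
  simp only [mul_one, one_mul] at h2a h2b
  have h2 := h2a.add h2b
  have h3 := h1.congr_isBigO (g := fun t ↦ f t * g t) (h2.congr_left fun t ↦ by
    simp only [Polynomial.eval_mul]; ring)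
  refine h3.congr_coeff fun j hj ↦ ?_
  rw [coeff_mul_eq_coeff_trunc_mul_trunc p q hj, Polynomial.coe_mul]

lemma pow (hf : ExpTo K f p) (k : ℕ) : ExpTo K (fun t ↦ f t ^ k) (p ^ k) := by
  induction k with
  | zero => simpa using const (K := K) 1
  | succ k ih => simpa only [pow_succ] using ih.mul hf

lemma coeff_eq_zero_of_pow {c : ℝ} {j : ℕ}
    (h : (fun t : ℝ ↦ t ^ j * c) =O[𝓝[≥] 0] fun t : ℝ ↦ t ^ (j + 1)) : c = 0 := by
  -- The point 0 is dropped from the filter so that `t ^ j` can be divided out.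
  have h1 : (fun t : ℝ ↦ c) =O[𝓝[>] 0] fun t : ℝ ↦ t := by
    have h2 := (h.mono (nhdsWithin_mono _ Ioi_subset_Ici_self)).mul
      (isBigO_refl (fun t : ℝ ↦ (t ^ j)⁻¹) (𝓝[>] 0))
    refine h2.congr' ?_ ?_ <;> filter_upwards [self_mem_nhdsWithin] with t ht <;>
      have : t ≠ 0 := ne_of_gt ht <;> field_simp
    ring
  have h3 : Tendsto (fun _ : ℝ ↦ c) (𝓝[>] 0) (𝓝 0) :=
    h1.trans_tendsto (tendsto_nhdsWithin_of_tendsto_nhds tendsto_id)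
  exact tendsto_nhds_unique tendsto_const_nhds h3

lemma unique (hp : ExpTo K f p) (hq : ExpTo K f q) : ∀ j < K, coeff j p = coeff j q := by
  intro j
  induction j using Nat.strong_induction_on with
  | _ j ih =>
    intro hj
    have h := (IsBigO.sub (hq.mono (Nat.succ_le_of_lt hj)) (hp.mono (Nat.succ_le_of_lt hj)))
    have h1 : coeff j p - coeff j q = 0 := by
      refine coeff_eq_zero_of_pow (h.congr_left fun t ↦ ?_)
      have h2 : ∑ i ∈ Finset.range j, t ^ i * coeff i p = ∑ i ∈ Finset.range j, t ^ i * coeff i q :=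
        Finset.sum_congr rfl fun i hi ↦ by
          rw [ih i (Finset.mem_range.1 hi) ((Finset.mem_range.1 hi).trans hj)]
      rw [Finset.sum_range_succ, Finset.sum_range_succ, h2]
      ring
    linarith

lemma ext (hp : ∀ K, ExpTo K f p) (hq : ∀ K, ExpTo K f q) : p = q :=
  PowerSeries.ext fun j ↦ unique (hp (j + 1)) (hq (j + 1)) j (Nat.lt_succ_self j)

/-- The filter `𝓝[≥] 0` sees the point 0 itself, where an `O(t)` bound forces equality. -/
lemma constantCoeff_eq (hp : ExpTo (K + 1) f p) : coeff 0 p = f 0 := by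
  obtain ⟨c, hc⟩ := (hp.mono (Nat.succ_le_succ (Nat.zero_le K))).bound
  have h := hc.self_of_nhdsWithin (mem_Ici.2 le_rfl)
  simp only [Nat.succ_eq_add_one, zero_add, Finset.range_one, Finset.sum_singleton, pow_zero,
    one_mul, pow_one, norm_zero, mul_zero, norm_le_zero_iff] at h
  linarith

end ExpTo

end AsympHyp

/-! ### Taylor series in the normal variable, with tangential parameters -/

namespace AsympHyp

section Jet

variable {E : Type*} [NormedAddCommGroup E] [NormedSpace ℝ E]

/-- The derivative of `F` in the direction `v`, within `S`. -/
def dirDeriv (S : Set (ℝ × E)) (v : ℝ × E) (F : ℝ × E → ℝ) (p : ℝ × E) : ℝ :=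
  fderivWithin ℝ F S p v

/-- The Taylor series at `t = 0` of `t ↦ F (t, w)`. -/
def jet (S : Set (ℝ × E)) (F : ℝ × E → ℝ) (w : E) : PowerSeries ℝ :=
  PowerSeries.mk fun j ↦ (dirDeriv S (1, 0))^[j] F (0, w) / (j.factorial : ℝ)

variable {ε : ℝ} {B : Set E} {F G : ℝ × E → ℝ}

lemma uniqueDiffOn_collar (hB : IsOpen B) : UniqueDiffOn ℝ (Ico 0 ε ×ˢ B) :=
  (uniqueDiffOn_Ico 0 ε).prod hB.uniqueDiffOn

lemma dirDeriv_congr {S : Set (ℝ × E)} (h : EqOn F G S) (v : ℝ × E) :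
    EqOn (dirDeriv S v F) (dirDeriv S v G) S := fun p hp ↦ by
  rw [dirDeriv, dirDeriv, fderivWithin_congr h (h hp)]

lemma contDiffOn_dirDeriv (hB : IsOpen B) (hF : ContDiffOn ℝ ∞ F (Ico 0 ε ×ˢ B)) (v : ℝ × E) :
    ContDiffOn ℝ ∞ (dirDeriv (Ico 0 ε ×ˢ B) v F) (Ico 0 ε ×ˢ B) :=
  (hF.fderivWithin (uniqueDiffOn_collar hB) (by simp)).clm_apply contDiffOn_const

lemma contDiffOn_iterate_dirDeriv (hB : IsOpen B) (hF : ContDiffOn ℝ ∞ F (Ico 0 ε ×ˢ B))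
    (v : ℝ × E) (j : ℕ) :
    ContDiffOn ℝ ∞ ((dirDeriv (Ico 0 ε ×ˢ B) v)^[j] F) (Ico 0 ε ×ˢ B) := by
  induction j with
  | zero => exact hF
  | succ j ih => rw [Function.iterate_succ_apply']; exact contDiffOn_dirDeriv hB ih v

lemma dirDeriv_comm (hε : 0 < ε) (hB : IsOpen B) (hF : ContDiffOn ℝ ∞ F (Ico 0 ε ×ˢ B))
    (v w : ℝ × E) :
    EqOn (dirDeriv (Ico 0 ε ×ˢ B) v (dirDeriv (Ico 0 ε ×ˢ B) w F))
      (dirDeriv (Ico 0 ε ×ˢ B) w (dirDeriv (Ico 0 ε ×ˢ B) v F)) (Ico 0 ε ×ˢ B) := by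
  intro p hp
  have hu := uniqueDiffOn_collar (ε := ε) hB
  have hd : DifferentiableWithinAt ℝ (fderivWithin ℝ F (Ico 0 ε ×ˢ B)) (Ico 0 ε ×ˢ B) p :=
    (hF.fderivWithin (m := ∞) hu (by simp)).differentiableOn (by simp) p hp
  have key : ∀ a b : ℝ × E, dirDeriv (Ico 0 ε ×ˢ B) a (dirDeriv (Ico 0 ε ×ˢ B) b F) p =
      fderivWithin ℝ (fderivWithin ℝ F (Ico 0 ε ×ˢ B)) (Ico 0 ε ×ˢ B) p a b := by
    intro a b
    have := (hd.hasFDerivWithinAt.clm_apply (hasFDerivWithinAt_const b p _)).fderivWithin (hu p hp)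
    unfold dirDeriv
    rw [this]
    simp
  rw [key, key]
  refine (ContDiffWithinAt.isSymmSndFDerivWithinAt (n := ∞) (hF p hp)
    (by
      rw [minSmoothness_of_isRCLikeNormedField]
      exact WithTop.coe_le_coe.2 (le_top : (2 : ℕ∞) ≤ ⊤)) hu ?_ hp).eq v w
  -- Symmetry of the second derivative within a set holds at limits of interior points; this covers
  -- the face `t = 0`.
  rw [interior_prod_eq, closure_prod_eq, interior_Ico, hB.interior_eq, closure_Ioo hε.ne]
  exact ⟨Ico_subset_Icc_self hp.1, subset_closure hp.2⟩

lemma iterate_dirDeriv_comm (hε : 0 < ε) (hB : IsOpen B) (hF : ContDiffOn ℝ ∞ F (Ico 0 ε ×ˢ B))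
    (v w : ℝ × E) (j : ℕ) :
    EqOn ((dirDeriv (Ico 0 ε ×ˢ B) v)^[j] (dirDeriv (Ico 0 ε ×ˢ B) w F))
      (dirDeriv (Ico 0 ε ×ˢ B) w ((dirDeriv (Ico 0 ε ×ˢ B) v)^[j] F)) (Ico 0 ε ×ˢ B) := by
  induction j with
  | zero => exact fun _ _ ↦ rfl
  | succ j ih =>
    simp only [Function.iterate_succ_apply']
    exact (dirDeriv_congr ih v).trans
      (dirDeriv_comm hε hB (contDiffOn_iterate_dirDeriv hB hF v j) v w)

lemma hasDerivWithinAt_slice (hF : ContDiffOn ℝ ∞ F (Ico 0 ε ×ˢ B)) {w : E} (hw : w ∈ B) {s t : ℝ}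
    (ht : t < ε) (hs : s ∈ Icc 0 t) :
    HasDerivWithinAt (fun s ↦ F (s, w)) (dirDeriv (Ico 0 ε ×ˢ B) (1, 0) F (s, w)) (Icc 0 t) s := by
  have hm : (s, w) ∈ Ico 0 ε ×ˢ B := ⟨⟨hs.1, hs.2.trans_lt ht⟩, hw⟩
  have h1 := (hF.differentiableOn (by simp) (s, w) hm).hasFDerivWithinAt
  have h2 : HasDerivWithinAt (fun s : ℝ ↦ (s, w)) ((1 : ℝ), (0 : E)) (Icc 0 t) s :=
    (hasDerivWithinAt_id s _).prodMk (hasDerivWithinAt_const s _ w)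
  have h3 : MapsTo (fun s : ℝ ↦ (s, w)) (Icc 0 t) (Ico 0 ε ×ˢ B) :=
    fun r hr ↦ ⟨⟨hr.1, hr.2.trans_lt ht⟩, hw⟩
  exact h1.comp_hasDerivWithinAt s h2 h3

lemma coeff_jet (S : Set (ℝ × E)) (F : ℝ × E → ℝ) (w : E) (j : ℕ) :
    PowerSeries.coeff j (jet S F w) = (dirDeriv S (1, 0))^[j] F (0, w) / (j.factorial : ℝ) := by
  simp [jet]

lemma coeff_zero_jet (S : Set (ℝ × E)) (F : ℝ × E → ℝ) (w : E) :
    PowerSeries.coeff 0 (jet S F w) = F (0, w) := by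
  simp [coeff_jet]

lemma coeff_jet_dirDeriv (S : Set (ℝ × E)) (F : ℝ × E → ℝ) (w : E) (j : ℕ) :
    PowerSeries.coeff j (jet S (dirDeriv S (1, 0) F) w) =
      PowerSeries.coeff (j + 1) (jet S F w) * (j + 1) := by
  rw [coeff_jet, coeff_jet, ← Function.iterate_succ_apply, Nat.factorial_succ]
  have : (j.factorial : ℝ) ≠ 0 := by positivity
  push_cast
  field_simp

lemma jet_dirDeriv (S : Set (ℝ × E)) (F : ℝ × E → ℝ) (w : E) :
    jet S (dirDeriv S (1, 0) F) w = PowerSeries.derivative ℝ (jet S F w) := by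
  ext j
  rw [coeff_jet_dirDeriv, PowerSeries.coeff_derivative]

/-- Taylor expansion in `t`, locally uniformly in `w`. -/
lemma exists_taylor_bound (hε : 0 < ε) (hB : IsOpen B) (hF : ContDiffOn ℝ ∞ F (Ico 0 ε ×ˢ B))
    {w₀ : E} (hw₀ : w₀ ∈ B) (K : ℕ) :
    ∃ C r : ℝ, 0 < r ∧ ∀ t ∈ Ico 0 r, ∀ w ∈ Metric.ball w₀ r,
      |F (t, w) - ∑ j ∈ Finset.range K,
        t ^ j * PowerSeries.coeff j (jet (Ico 0 ε ×ˢ B) F w)| ≤ C * t ^ K := by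
  induction K generalizing F with
  | zero =>
    have h0 : ((0 : ℝ), w₀) ∈ Ico 0 ε ×ˢ B := ⟨⟨le_rfl, hε⟩, hw₀⟩
    have h1 : ∀ᶠ p in 𝓝[Ico 0 ε ×ˢ B] ((0 : ℝ), w₀), |F p| < |F (0, w₀)| + 1 :=
      (hF.continuousOn _ h0).abs.eventually_lt_const (lt_add_one _)
    obtain ⟨r, hr, h2⟩ := Metric.mem_nhdsWithin_iff.1 h1
    obtain ⟨r', hr', h3⟩ := Metric.isOpen_iff.1 hB w₀ hw₀
    refine ⟨|F (0, w₀)| + 1, min r (min r' ε), by positivity, fun t ht w hw ↦ ?_⟩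
    have hw1 : w ∈ Metric.ball w₀ r := Metric.ball_subset_ball (min_le_left _ _) hw
    have hw2 : w ∈ Metric.ball w₀ r' :=
      Metric.ball_subset_ball ((min_le_right _ _).trans (min_le_left _ _)) hw
    have ht1 : t < r := ht.2.trans_le (min_le_left _ _)
    have ht2 : t < ε := ht.2.trans_le ((min_le_right _ _).trans (min_le_right _ _))
    have : (t, w) ∈ Metric.ball ((0 : ℝ), w₀) r ∩ Ico 0 ε ×ˢ B := by
      refine ⟨?_, ⟨ht.1, ht2⟩, h3 hw2⟩
      rw [← ball_prod_same]
      exact ⟨by simpa [abs_of_nonneg ht.1] using ht1, hw1⟩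
    simpa using (h2 this).le
  | succ K ih =>
    -- The bound of order `K` for `∂ₜF` controls the `t`-derivative of the remainder of `F`; the
    -- mean value inequality from `t = 0`, where the remainder vanishes, gains one power of `t`.
    obtain ⟨C, r, hr, h⟩ := ih (contDiffOn_dirDeriv hB hF (1, 0))
    obtain ⟨r', hr', h3⟩ := Metric.isOpen_iff.1 hB w₀ hw₀
    refine ⟨|C|, min r (min r' ε), by positivity, fun t ht w hw ↦ ?_⟩
    have hw1 : w ∈ Metric.ball w₀ r := Metric.ball_subset_ball (min_le_left _ _) hw
    have hw2 : w ∈ B :=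
      h3 (Metric.ball_subset_ball ((min_le_right _ _).trans (min_le_left _ _)) hw)
    have ht1 : t < r := ht.2.trans_le (min_le_left _ _)
    have ht2 : t < ε := ht.2.trans_le ((min_le_right _ _).trans (min_le_right _ _))
    have hd : ∀ s ∈ Icc 0 t, HasDerivWithinAt (fun s ↦ F (s, w) - ∑ j ∈ Finset.range (K + 1),
        s ^ j * PowerSeries.coeff j (jet (Ico 0 ε ×ˢ B) F w))
        (dirDeriv (Ico 0 ε ×ˢ B) (1, 0) F (s, w) - ∑ j ∈ Finset.range K, s ^ j *
          PowerSeries.coeff j (jet (Ico 0 ε ×ˢ B) (dirDeriv (Ico 0 ε ×ˢ B) (1, 0) F) w))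
        (Icc 0 t) s := by
      intro s hs
      refine (hasDerivWithinAt_slice hF hw2 ht2 hs).sub ?_
      have := HasDerivAt.fun_sum (u := Finset.range (K + 1)) fun j _ ↦
        (hasDerivAt_pow j s).mul_const (PowerSeries.coeff j (jet (Ico 0 ε ×ˢ B) F w))
      refine (this.congr_deriv ?_).hasDerivWithinAt
      rw [Finset.sum_range_succ']
      simp only [Nat.cast_zero, zero_mul, add_zero, coeff_jet_dirDeriv]
      refine Finset.sum_congr rfl fun j _ ↦ ?_
      push_cast
      ring
    have hb := norm_image_sub_le_of_norm_deriv_le_segment' (C := |C| * t ^ K) hd (fun s hs ↦ by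
      refine (h s ⟨hs.1, hs.2.trans ht1⟩ w hw1).trans ?_
      have : s ^ K ≤ t ^ K := pow_le_pow_left₀ hs.1 hs.2.le K
      have h0 : 0 ≤ s ^ K := pow_nonneg hs.1 K
      calc C * s ^ K ≤ |C| * s ^ K := by gcongr; exact le_abs_self C
        _ ≤ |C| * t ^ K := by gcongr) t (right_mem_Icc.2 ht.1)
    simp only [Real.norm_eq_abs, sub_zero] at hb
    rw [Finset.sum_range_succ' (fun j ↦ (0 : ℝ) ^ j * _)] at hb
    simp only [ne_eq, Nat.add_eq_zero_iff, one_ne_zero, and_false, not_false_eq_true, zero_pow,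
      zero_mul, Finset.sum_const_zero, pow_zero, one_mul, coeff_zero_jet, zero_add, sub_self,
      sub_zero] at hb
    rw [pow_succ, ← mul_assoc]
    exact hb

lemma expTo_jet (hε : 0 < ε) (hB : IsOpen B) (hF : ContDiffOn ℝ ∞ F (Ico 0 ε ×ˢ B))
    {w : E} (hw : w ∈ B) (K : ℕ) :
    ExpTo K (fun t ↦ F (t, w)) (jet (Ico 0 ε ×ˢ B) F w) := by
  obtain ⟨C, r, hr, h⟩ := exists_taylor_bound hε hB hF hw K
  refine IsBigO.of_bound C ?_
  filter_upwards [Ico_mem_nhdsGE hr] with t ht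
  rw [Real.norm_eq_abs, Real.norm_eq_abs, abs_of_nonneg (pow_nonneg ht.1 K)]
  exact h t ht w (Metric.mem_ball_self hr)

lemma hasFDerivAt_zero_slice (hε : 0 < ε) (hB : IsOpen B) (hF : ContDiffOn ℝ ∞ F (Ico 0 ε ×ˢ B))
    {w : E} (hw : w ∈ B) :
    HasFDerivAt (fun w ↦ F (0, w))
      ((fderivWithin ℝ F (Ico 0 ε ×ˢ B) (0, w)).comp (ContinuousLinearMap.inr ℝ ℝ E)) w := by
  have h1 := (hF.differentiableOn (by simp) (0, w) ⟨⟨le_rfl, hε⟩, hw⟩).hasFDerivWithinAt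
  have h2 : HasFDerivWithinAt (fun w : E ↦ ((0 : ℝ), w)) (ContinuousLinearMap.inr ℝ ℝ E) B w :=
    (hasFDerivAt_prodMk_right (0 : ℝ) w).hasFDerivWithinAt
  exact (h1.comp w h2 fun v hv ↦ ⟨⟨le_rfl, hε⟩, hv⟩).hasFDerivAt (hB.mem_nhds hw)

/-- A tangential derivative at `t = 0` sees only the restriction to the boundary. It is used with `L
= 0`, for functions vanishing there, and with `L` a coordinate, for the components of `z`. -/
lemma dirDeriv_zero_slice (hε : 0 < ε) (hB : IsOpen B) (hF : ContDiffOn ℝ ∞ F (Ico 0 ε ×ˢ B))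
    {w : E} (hw : w ∈ B) {L : E →L[ℝ] ℝ} {c : ℝ} (hL : ∀ w ∈ B, F (0, w) = L w + c) (v : E) :
    dirDeriv (Ico 0 ε ×ˢ B) (0, v) F (0, w) = L v := by
  have h1 := hasFDerivAt_zero_slice hε hB hF hw
  have h2 : HasFDerivAt (fun w ↦ F (0, w)) L w := by
    refine (L.hasFDerivAt.add_const c).congr_of_eventuallyEq ?_
    filter_upwards [hB.mem_nhds hw] with w' hw' using hL w' hw'
  simpa [dirDeriv] using congrArg (fun A : E →L[ℝ] ℝ ↦ A v) (h1.unique h2)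

/-- A Taylor coefficient that vanishes for all `w` also vanishes for tangential derivatives. -/
lemma coeff_jet_tangential_eq_zero (hε : 0 < ε) (hB : IsOpen B)
    (hF : ContDiffOn ℝ ∞ F (Ico 0 ε ×ˢ B)) {j : ℕ}
    (h : ∀ w ∈ B, PowerSeries.coeff j (jet (Ico 0 ε ×ˢ B) F w) = 0) {w : E} (hw : w ∈ B) (v : E) :
    PowerSeries.coeff j (jet (Ico 0 ε ×ˢ B) (dirDeriv (Ico 0 ε ×ˢ B) (0, v) F) w) = 0 := by
  have hj : (j.factorial : ℝ) ≠ 0 := by positivity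
  rw [coeff_jet, iterate_dirDeriv_comm hε hB hF _ _ _ ⟨⟨le_rfl, hε⟩, hw⟩,
    dirDeriv_zero_slice hε hB (contDiffOn_iterate_dirDeriv hB hF _ j) hw (L := 0) (c := 0)]
  · simp
  · intro w hw
    have := h w hw
    rw [coeff_jet, div_eq_zero_iff] at this
    simpa [hj] using this

lemma contDiffOn_coeff_jet (hε : 0 < ε) (hB : IsOpen B) (hF : ContDiffOn ℝ ∞ F (Ico 0 ε ×ˢ B))
    (j : ℕ) : ContDiffOn ℝ ∞ (fun w ↦ PowerSeries.coeff j (jet (Ico 0 ε ×ˢ B) F w)) B := by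
  simp only [coeff_jet]
  refine ContDiffOn.div_const ?_ _
  exact (contDiffOn_iterate_dirDeriv hB hF _ j).comp (contDiffOn_const.prodMk contDiffOn_id)
    fun w hw ↦ ⟨⟨le_rfl, hε⟩, hw⟩

end Jet

end AsympHyp

/-! ### Parity of truncated series, and the recursion steps -/

namespace AsympHyp

open PowerSeries

/-- The odd coefficients of `f` of order less than `k` vanish. -/
def IsEvenMod (k : ℕ) (f : PowerSeries ℝ) : Prop := ∀ j < k, Odd j → coeff j f = 0

/-- The even coefficients of `f` of order less than `k` vanish. -/
def IsOddMod (k : ℕ) (f : PowerSeries ℝ) : Prop := ∀ j < k, Even j → coeff j f = 0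

section Parity

variable {k l : ℕ} {f g : PowerSeries ℝ}

lemma coeff_zero_mul_eq (f g : PowerSeries ℝ) : coeff 0 (f * g) = coeff 0 f * coeff 0 g := by
  simp

lemma IsEvenMod.mono (h : IsEvenMod k f) (hl : l ≤ k) : IsEvenMod l f :=
  fun j hj ↦ h j (hj.trans_le hl)

lemma IsOddMod.mono (h : IsOddMod k f) (hl : l ≤ k) : IsOddMod l f :=
  fun j hj ↦ h j (hj.trans_le hl)

lemma IsEvenMod.add (hf : IsEvenMod k f) (hg : IsEvenMod k g) : IsEvenMod k (f + g) :=
  fun j hj ho ↦ by simp [hf j hj ho, hg j hj ho]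

lemma isEvenMod_sum {ι : Type*} (s : Finset ι) {f : ι → PowerSeries ℝ}
    (h : ∀ i ∈ s, IsEvenMod k (f i)) : IsEvenMod k (∑ i ∈ s, f i) := fun j hj ho ↦ by
  rw [map_sum]
  exact Finset.sum_eq_zero fun i hi ↦ h i hi j hj ho

lemma isEvenMod_C (c : ℝ) : IsEvenMod k (C c) := fun j _ ho ↦ by
  rw [coeff_C, if_neg ho.pos.ne']

lemma IsEvenMod.mul (hf : IsEvenMod k f) (hg : IsEvenMod k g) : IsEvenMod k (f * g) := by
  intro j hj ho
  rw [coeff_mul]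
  refine Finset.sum_eq_zero fun ⟨p, q⟩ hpq ↦ ?_
  have hpq : p + q = j := Finset.HasAntidiagonal.mem_antidiagonal.1 hpq
  rcases Nat.even_or_odd p with hp | hp
  · rw [hg q (by omega) (by grind), mul_zero]
  · rw [hf p (by omega) hp, zero_mul]

lemma IsEvenMod.mul_odd (hf : IsEvenMod k f) (hg : IsOddMod k g) : IsOddMod k (f * g) := by
  intro j hj ho
  rw [coeff_mul]
  refine Finset.sum_eq_zero fun ⟨p, q⟩ hpq ↦ ?_
  have hpq : p + q = j := Finset.HasAntidiagonal.mem_antidiagonal.1 hpq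
  rcases Nat.even_or_odd p with hp | hp
  · rw [hg q (by omega) (by grind), mul_zero]
  · rw [hf p (by omega) hp, zero_mul]

lemma IsOddMod.mul (hf : IsOddMod k f) (hg : IsOddMod k g) : IsEvenMod k (f * g) := by
  intro j hj ho
  rw [coeff_mul]
  refine Finset.sum_eq_zero fun ⟨p, q⟩ hpq ↦ ?_
  have hpq : p + q = j := Finset.HasAntidiagonal.mem_antidiagonal.1 hpq
  rcases Nat.even_or_odd p with hp | hp
  · rw [hf p (by omega) hp, zero_mul]
  · rw [hg q (by omega) (by grind), mul_zero]

lemma IsEvenMod.pow (hf : IsEvenMod k f) (j : ℕ) : IsEvenMod k (f ^ j) := by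
  induction j with
  | zero => simpa using isEvenMod_C (k := k) 1
  | succ j ih => rw [pow_succ]; exact ih.mul hf

lemma IsEvenMod.derivative (hf : IsEvenMod (k + 1) f) :
    IsOddMod k (PowerSeries.derivative ℝ f) := fun j hj he ↦ by
  rw [coeff_derivative, hf (j + 1) (by omega) he.add_one, zero_mul]

lemma IsOddMod.derivative (hf : IsOddMod (k + 1) f) :
    IsEvenMod k (PowerSeries.derivative ℝ f) := fun j hj he ↦ by
  rw [coeff_derivative, hf (j + 1) (by omega) he.add_one, zero_mul]

lemma IsEvenMod.X_mul (hf : IsEvenMod k f) : IsOddMod (k + 1) (X * f) := fun j hj he ↦ by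
  cases j with
  | zero => simp
  | succ j => rw [coeff_succ_X_mul, hf j (by omega) (by grind)]

lemma IsOddMod.X_mul (hf : IsOddMod k f) : IsEvenMod (k + 1) (X * f) := fun j hj he ↦ by
  cases j with
  | zero => simp
  | succ j => rw [coeff_succ_X_mul, hf j (by omega) (by grind)]

lemma IsOddMod.of_X_mul (hf : IsOddMod (k + 1) (X * f)) : IsEvenMod k f := fun j hj he ↦ by
  rw [← coeff_succ_X_mul, hf (j + 1) (by omega) (by grind)]

lemma IsEvenMod.succ (hf : IsEvenMod k f) (h : Odd k → coeff k f = 0) : IsEvenMod (k + 1) f :=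
  fun j hj ho ↦ by
    rcases (Nat.lt_succ_iff.1 hj).lt_or_eq with h1 | rfl
    · exact hf j h1 ho
    · exact h ho

lemma coeff_mul_of_isOddMod (hf : IsOddMod k f) (hg : IsEvenMod (k + 1) g) (hk : Even k) :
    coeff k (f * g) = coeff k f * coeff 0 g := by
  rw [coeff_mul, Finset.sum_eq_single (k, 0)]
  · rintro ⟨p, q⟩ hpq hne
    have hpq : p + q = k := Finset.HasAntidiagonal.mem_antidiagonal.1 hpq
    have hq : q ≠ 0 := fun h ↦ hne (by subst h; simp_all)
    rcases Nat.even_or_odd p with hp | hp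
    · rw [hf p (by omega) hp, zero_mul]
    · rw [hg q (by omega) (by grind), mul_zero]
  · simp

/-- In `p + q = k` one index is odd. If it is `p`, the factor from `f` vanishes, including for `p =
k`; if it is `q < k`, the factor from `g` does. Only `(0, k)` survives. -/
lemma coeff_mul_of_isEvenMod (hf : IsEvenMod (k + 1) f) (hg : IsEvenMod k g) (hk : Odd k) :
    coeff k (f * g) = coeff 0 f * coeff k g := by
  rw [coeff_mul, Finset.sum_eq_single (0, k)]
  · rintro ⟨p, q⟩ hpq hne
    have hpq : p + q = k := Finset.HasAntidiagonal.mem_antidiagonal.1 hpq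
    have hp : p ≠ 0 := fun h ↦ hne (by subst h; simp_all)
    rcases Nat.even_or_odd p with hp | hp
    · rw [hg q (by omega) (by grind), mul_zero]
    · rw [hf p (by omega) hp, zero_mul]
  · simp

/-- At the first odd order where `g` might fail to vanish, the coefficient of the product collapses
to `coeff 0 f` times that of `g`. -/
lemma IsEvenMod.of_mul (hf : IsEvenMod k f) (h0 : coeff 0 f ≠ 0) (hfg : IsEvenMod k (f * g)) :
    IsEvenMod k g := by
  intro j
  induction j using Nat.strong_induction_on with
  | _ j ih =>
    intro hj ho
    have h := coeff_mul_of_isEvenMod (k := j) (hf.mono hj) (fun i hi ↦ ih i hi (hi.trans hj)) ho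
    rw [hfg j hj ho] at h
    exact (mul_eq_zero.1 h.symm).resolve_left h0

end Parity

section Step

variable {ι : Type*} [Fintype ι] {k : ℕ}
  {Z : ι → PowerSeries ℝ} {H D : ι → ι → PowerSeries ℝ} {U V : PowerSeries ℝ}
  {T : ι → PowerSeries ℝ}

/-- One step of the parity recursion for the boundary components `Z`, from the mixed components of
the metric identity. -/
lemma isEvenMod_boundary_step [DecidableEq ι] (hk : Odd k) (hZ : ∀ a, IsEvenMod k (Z a))
    (hU : IsOddMod (k + 1) U) (hH : ∀ a b, IsEvenMod k (H a b)) (hD : ∀ a i, IsEvenMod k (D a i))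
    (hT : ∀ i, IsOddMod k (T i))
    (hD0 : ∀ a i, coeff 0 (D a i) = if a = i then 1 else 0)
    (hH0 : ∀ c : ι → ℝ, (∀ b, ∑ a, c a * coeff 0 (H a b) = 0) → c = 0)
    (heq : ∀ i, 0 = PowerSeries.derivative ℝ U * T i +
      ∑ a, ∑ b, PowerSeries.derivative ℝ (Z a) * H a b * D b i) (a : ι) :
    IsEvenMod (k + 2) (Z a) := by
  obtain ⟨j, rfl⟩ : ∃ j, k = j + 1 := ⟨k - 1, by have := hk.pos; omega⟩
  have hj : Even j := by grind
  -- At the even order `j = k - 1` the term `U' T` drops out, being odd. Each `Z a` has derivative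
  -- odd below `j`, so it meets only the constant terms of `H` and `D`, the latter being the
  -- identity.
  have key : (fun a ↦ coeff j (PowerSeries.derivative ℝ (Z a))) = 0 := by
    refine hH0 _ fun i ↦ ?_
    have h := congrArg (coeff j) (heq i)
    rw [map_zero, map_add, (hU.derivative.mul_odd (hT i)) j (Nat.lt_succ_self j) hj, zero_add,
      map_sum] at h
    rw [h]
    refine Finset.sum_congr rfl fun a _ ↦ ?_
    have h1 : ∑ b, PowerSeries.derivative ℝ (Z a) * H a b * D b i =
        PowerSeries.derivative ℝ (Z a) * ∑ b, H a b * D b i := by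
      rw [Finset.mul_sum]
      exact Finset.sum_congr rfl fun b _ ↦ by ring
    rw [h1, coeff_mul_of_isOddMod (hZ a).derivative
      (isEvenMod_sum _ fun b _ ↦ (hH a b).mul (hD b i)) hj, map_sum]
    congr 1
    rw [Finset.sum_eq_single i]
    · rw [coeff_zero_mul_eq, hD0, if_pos rfl, mul_one]
    · intro b _ hb
      rw [coeff_zero_mul_eq, hD0, if_neg hb, mul_zero]
    · simp
  -- The order `k + 1` is even, so the second increment costs nothing.
  refine ((hZ a).succ fun _ ↦ ?_).succ fun h ↦ by grind
  have h := congrFun key a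
  simp only [coeff_derivative, Pi.zero_apply, mul_eq_zero] at h
  exact h.resolve_right (by positivity)

/-- One step of the parity recursion for the defining function `X * V`, from the normal component
of the metric identity. -/
lemma isEvenMod_defining_step (hk : Odd k) (hZ : ∀ a, IsEvenMod (k + 2) (Z a))
    (hV : IsEvenMod k V) (hV0 : coeff 0 V ≠ 0) (hH : ∀ a b, IsEvenMod k (H a b))
    (heq : (X * V) ^ 2 = X ^ 2 * (PowerSeries.derivative ℝ (X * V) ^ 2 +
      ∑ a, ∑ b, PowerSeries.derivative ℝ (Z a) * H a b * PowerSeries.derivative ℝ (Z b))) :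
    IsEvenMod (k + 2) V := by
  -- `Z a` has no linear term, so the boundary part of the identity carries an extra `X ^ 2`, and
  -- its quotient by `X ^ 2` is even below `k`.
  have hY : ∀ a, ∃ Y, PowerSeries.derivative ℝ (Z a) = X * Y := fun a ↦ by
    refine X_dvd_iff.2 ?_
    rw [← coeff_zero_eq_constantCoeff_apply]
    exact (hZ a).derivative 0 (by omega) Even.zero
  choose Y hY using hY
  have hYe : ∀ a, IsEvenMod k (Y a) := fun a ↦
    IsOddMod.of_X_mul (hY a ▸ (hZ a).derivative)
  set Q := ∑ a, ∑ b, Y a * H a b * Y b with hQ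
  have hQe : IsEvenMod k Q :=
    isEvenMod_sum _ fun a _ ↦ isEvenMod_sum _ fun b _ ↦ ((hYe a).mul (hH a b)).mul (hYe b)
  have hsum : ∑ a, ∑ b, PowerSeries.derivative ℝ (Z a) * H a b * PowerSeries.derivative ℝ (Z b) =
      X ^ 2 * Q := by
    rw [hQ, Finset.mul_sum]
    refine Finset.sum_congr rfl fun a _ ↦ ?_
    rw [Finset.mul_sum]
    exact Finset.sum_congr rfl fun b _ ↦ by rw [hY, hY]; ring
  have hdX : PowerSeries.derivative ℝ (X * V) = V + X * PowerSeries.derivative ℝ V := by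
    rw [Derivation.leibniz, PowerSeries.derivative_X]
    simp [add_comm]
  rw [hsum, hdX] at heq
  -- With `(X V)' = V + X V'` the terms `X² V²` cancel and a common factor `X³` splits off.
  have h0 : PowerSeries.derivative ℝ V * (C 2 * V + X * PowerSeries.derivative ℝ V) + X * Q = 0 := by
    have h2 : (C 2 : PowerSeries ℝ) = 2 := map_ofNat C 2
    have h3 : X ^ 3 *
        (PowerSeries.derivative ℝ V * (C 2 * V + X * PowerSeries.derivative ℝ V) + X * Q) = 0 := by
      rw [h2]; linear_combination -heq
    exact (mul_eq_zero.1 h3).resolve_left (pow_ne_zero _ X_ne_zero)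
  obtain ⟨j, rfl⟩ : ∃ j, k = j + 1 := ⟨k - 1, by have := hk.pos; omega⟩
  have hj : Even j := by grind
  have h := congrArg (coeff j) h0
  rw [map_add, map_zero, (hQe.X_mul) j (by omega) hj, add_zero,
    coeff_mul_of_isOddMod hV.derivative
      (((isEvenMod_C 2).mul hV).add hV.derivative.X_mul) hj] at h
  refine (hV.succ fun _ ↦ ?_).succ fun h ↦ by grind
  have h1 : coeff 0 (C 2 * V + X * PowerSeries.derivative ℝ V) = 2 * coeff 0 V := by
    rw [map_add, coeff_C_mul, coeff_zero_X_mul, add_zero]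
  rw [h1, coeff_derivative, mul_eq_zero, mul_eq_zero] at h
  exact (h.resolve_right (mul_ne_zero two_ne_zero hV0)).resolve_right (by positivity)

/-- The tangential components of the metric identity, read off at order `k`. -/
lemma isEvenMod_tangential [DecidableEq ι] (hk : Odd k) (hV : IsEvenMod (k + 1) V) (hV0 : coeff 0 V ≠ 0)
    (hH : ∀ a b, IsEvenMod k (H a b)) (hD : ∀ a i, IsEvenMod (k + 1) (D a i))
    (hT : ∀ i, IsOddMod (k + 1) (T i))
    (hT0 : ∀ i, coeff 0 (T i) = 0)
    (hD0 : ∀ a i, coeff 0 (D a i) = if a = i then 1 else 0) {h' : ι → ι → PowerSeries ℝ}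
    (heq : ∀ i j, (X * V) ^ 2 * h' i j = X ^ 2 * (T i * T j + ∑ a, ∑ b, D a i * H a b * D b j))
    (i j : ι) :
    IsEvenMod k (h' i j) ∧ coeff 0 V ^ 2 * coeff 0 (h' i j) = coeff 0 (H i j) ∧
      coeff 0 V ^ 2 * coeff k (h' i j) = coeff k (H i j) := by
  have h0 : V ^ 2 * h' i j = T i * T j + ∑ a, ∑ b, (D a i * D b j) * H a b := by
    refine mul_left_cancel₀ (pow_ne_zero 2 (X_ne_zero (R := ℝ))) ?_
    rw [← mul_assoc, ← mul_pow, heq]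
    congr 2
    exact Finset.sum_congr rfl fun a _ ↦ Finset.sum_congr rfl fun b _ ↦ by ring
  have hV2 : coeff 0 (V ^ 2) = coeff 0 V ^ 2 := by simp
  have hpick : ∀ F : ι → ι → ℝ, ∑ a, ∑ b,
      ((if a = i then (1 : ℝ) else 0) * (if b = j then (1 : ℝ) else 0)) * F a b = F i j := by
    intro F
    simp
  have he : IsEvenMod k (h' i j) := by
    refine ((hV.mono (Nat.le_succ k)).pow 2).of_mul (by rw [hV2]; exact pow_ne_zero 2 hV0) ?_
    rw [h0]
    exact (((hT i).mul (hT j)).mono (Nat.le_succ k)).add (isEvenMod_sum _ fun a _ ↦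
      isEvenMod_sum _ fun b _ ↦ (((hD a i).mul (hD b j)).mono (Nat.le_succ k)).mul (hH a b))
  refine ⟨he, ?_, ?_⟩
  · have := congrArg (coeff 0) h0
    rw [coeff_zero_mul_eq, hV2] at this
    rw [this]
    simp only [map_add, map_sum, coeff_zero_mul_eq, hT0, hD0, hpick]
    simp
  -- At odd order `k`, `V ^ 2` and the products of two `D` are even through order `k`, so only their
  -- constant terms act; `T i * T j` contributes nothing.
  · have := congrArg (coeff k) h0
    rw [coeff_mul_of_isEvenMod (hV.pow 2) he hk, hV2, map_add,
      ((hT i).mul (hT j)) k (Nat.lt_succ_self k) hk, zero_add] at this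
    rw [this, ← hpick fun a b ↦ coeff k (H a b), map_sum]
    refine Finset.sum_congr rfl fun a _ ↦ ?_
    rw [map_sum]
    refine Finset.sum_congr rfl fun b _ ↦ ?_
    rw [coeff_mul_of_isEvenMod ((hD a i).mul (hD b j)) (hH a b) hk, coeff_zero_mul_eq, hD0, hD0]

end Step

end AsympHyp

/-! ### Composition with curves of prescribed parity -/

namespace AsympHyp

open PowerSeries Filter

section Composition

lemma exists_expTo_of_contDiffAt {G : ℝ → ℝ} (hG : ContDiffAt ℝ ∞ G 0) (K : ℕ) :
    ∃ g : PowerSeries ℝ, (fun t : ℝ ↦ G t - ∑ j ∈ Finset.range K, t ^ j * coeff j g)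
      =O[𝓝 0] fun t : ℝ ↦ t ^ K := by
  obtain ⟨s, hs, h⟩ := hG.contDiffOn (m := K) (by exact_mod_cast le_top) (by simp)
  obtain ⟨δ, hδ, hs⟩ := Metric.mem_nhds_iff.1 hs
  have h1 := taylor_isLittleO (convex_ball (0 : ℝ) δ) (Metric.mem_ball_self hδ) (h.mono hs)
  rw [nhdsWithin_eq_nhds.2 (Metric.ball_mem_nhds _ hδ)] at h1
  refine ⟨PowerSeries.mk fun j ↦ iteratedDerivWithin j G (Metric.ball 0 δ) 0 / j.factorial, ?_⟩
  simp only [sub_zero] at h1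
  have h2 : (fun t : ℝ ↦ t ^ K *
      (iteratedDerivWithin K G (Metric.ball 0 δ) 0 / K.factorial)) =O[𝓝 0] fun t : ℝ ↦ t ^ K := by
    simp only [mul_comm _ (_ / _)]
    exact (isBigO_refl _ _).const_mul_left _
  refine (h1.isBigO.add h2).congr_left fun t ↦ ?_
  rw [taylor_within_apply, Finset.sum_range_succ]
  simp only [sub_zero, smul_eq_mul, coeff_mk]
  have : ∀ j : ℕ, (j.factorial : ℝ)⁻¹ * t ^ j * iteratedDerivWithin j G (Metric.ball 0 δ) 0 =
      t ^ j * (iteratedDerivWithin j G (Metric.ball 0 δ) 0 / j.factorial) := fun j ↦ by ring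
  simp only [this]
  ring

/-- The two-sided expansion and its reflection under `t ↦ -t` both expand `G`, so by uniqueness the
odd coefficients equal their negatives. -/
lemma exists_expTo_of_even {G : ℝ → ℝ} (hG : ContDiffAt ℝ ∞ G 0) (he : ∀ t, G (-t) = G t)
    (K : ℕ) : ∃ g : PowerSeries ℝ, ExpTo K G g ∧ IsEvenMod K g := by
  obtain ⟨g, hg⟩ := exists_expTo_of_contDiffAt hG K
  have h1 : ExpTo K G g := hg.mono nhdsWithin_le_nhds
  have hneg : Tendsto (fun t : ℝ ↦ -t) (𝓝 0) (𝓝 0) := by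
    simpa using (continuous_neg (G := ℝ)).tendsto 0
  have h2 : ExpTo K G (PowerSeries.mk fun j ↦ (-1) ^ j * coeff j g) := by
    have h3 := (hg.comp_tendsto hneg).mono (nhdsWithin_le_nhds (s := Ici 0))
    have h4 : ((fun t : ℝ ↦ t ^ K) ∘ fun t : ℝ ↦ -t) =O[𝓝[≥] 0] fun t : ℝ ↦ t ^ K :=
      IsBigO.of_bound 1 (Eventually.of_forall fun t ↦ by simp)
    refine (h3.trans h4).congr_left fun t ↦ ?_
    simp only [Function.comp, he, coeff_mk]
    congr 1
    refine Finset.sum_congr rfl fun j _ ↦ ?_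
    rw [neg_pow]; ring
  refine ⟨g, h1, fun j hj ho ↦ ?_⟩
  have := h1.unique h2 j hj
  rw [coeff_mk, ho.neg_one_pow] at this
  linarith

variable {m : ℕ}

lemma isBigO_of_components {α F : Type*} [Norm F] {l : Filter α}
    {f : α → EuclideanSpace ℝ (Fin m)}
    {g : α → F} (h : ∀ a, (fun x ↦ f x a) =O[l] g) : f =O[l] g := by
  have h1 : f = fun x ↦ ∑ a, f x a • EuclideanSpace.single a (1 : ℝ) := by
    ext x i
    simp [Pi.single_apply]
  rw [h1]
  refine IsBigO.fun_sum fun a _ ↦ ?_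
  refine IsBigO.trans (IsBigO.of_bound 1 (Eventually.of_forall fun x ↦ ?_)) (h a)
  simp [norm_smul]

/-- The expansion of a smooth function along a curve with partially even expansion. -/
lemma exists_expTo_comp {c : EuclideanSpace ℝ (Fin m) → ℝ} {y : EuclideanSpace ℝ (Fin m)}
    (hc : ContDiffAt ℝ ∞ c y) {l : ℕ} (hl : 0 < l) {z : ℝ → EuclideanSpace ℝ (Fin m)}
    (hz0 : z 0 = y) {p : Fin m → PowerSeries ℝ}
    (hz : ∀ a, ExpTo l (fun t ↦ z t a) (p a)) (hp : ∀ a, IsEvenMod l (p a)) :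
    ∃ g, ExpTo l (fun t ↦ c (z t)) g ∧ IsEvenMod l g ∧ coeff 0 g = c y := by
  obtain ⟨l, rfl⟩ : ∃ j, l = j + 1 := ⟨l - 1, by omega⟩
  -- The curve `z` is controlled only for `t ≥ 0`. Its truncated series has even terms only, and so
  -- defines a smooth even curve on the whole line; `c ∘ P` is then even, and a local Lipschitz
  -- bound on `c` transfers the expansion to `c ∘ z`.
  set P : ℝ → EuclideanSpace ℝ (Fin m) :=
    fun t ↦ WithLp.toLp 2 fun a ↦ (trunc (l + 1) (p a)).eval t with hP
  have hPs : ContDiff ℝ ∞ P := by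
    refine contDiff_euclidean.2 fun a ↦ ?_
    have h := (trunc (l + 1) (p a)).contDiff_aeval (𝕜 := ℝ) ∞
    simp only [Polynomial.coe_aeval_eq_eval] at h
    exact h
  have hPe : ∀ t, P (-t) = P t := by
    intro t
    simp only [hP]
    congr 1
    funext a
    rw [Polynomial.eval_eq_sum_range, Polynomial.eval_eq_sum_range]
    refine Finset.sum_congr rfl fun j _ ↦ ?_
    rcases Nat.even_or_odd j with hj | hj
    · rw [hj.neg_pow]
    · have : (trunc (l + 1) (p a)).coeff j = 0 := by
        rw [coeff_trunc]
        split_ifs with h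
        · exact hp a j h hj
        · rfl
      rw [this, zero_mul, zero_mul]
  have hP0 : P 0 = y := by
    ext a
    have h := (hz a).constantCoeff_eq
    simp only [hz0] at h
    simp only [hP, ← Polynomial.coeff_zero_eq_eval_zero, coeff_trunc]
    simpa using h
  have hd : (fun t ↦ z t - P t) =O[𝓝[≥] 0] fun t : ℝ ↦ t ^ (l + 1) :=
    isBigO_of_components fun a ↦ by simpa [hP] using (hz a).sub_trunc
  have hPt : Tendsto P (𝓝[≥] 0) (𝓝 y) := by
    simpa [hP0] using (hPs.continuous.tendsto 0).mono_left nhdsWithin_le_nhds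
  have hpow : Tendsto (fun t : ℝ ↦ t ^ (l + 1)) (𝓝[≥] 0) (𝓝 0) := by
    have := ((continuous_pow (l + 1)).tendsto (0 : ℝ)).mono_left (nhdsWithin_le_nhds (s := Ici 0))
    simpa using this
  have hzt : Tendsto z (𝓝[≥] 0) (𝓝 y) := by
    simpa using (hd.trans_tendsto hpow).add hPt
  obtain ⟨g, hg, hge⟩ := exists_expTo_of_even (G := fun t ↦ c (P t))
    (ContDiffAt.comp (0 : ℝ) (by rwa [hP0]) hPs.contDiffAt) (fun t ↦ by rw [hPe]) (l + 1)
  obtain ⟨L, s, hs, hL⟩ := (hc.of_le (m := 1) (by simp)).exists_lipschitzOnWith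
  have hcd : (fun t ↦ c (z t) - c (P t)) =O[𝓝[≥] 0] fun t ↦ z t - P t := by
    refine IsBigO.of_bound L ?_
    filter_upwards [hzt hs, hPt hs] with t h1 h2
    exact hL.norm_sub_le h1 h2
  refine ⟨g, hg.congr_isBigO (hcd.trans hd), hge, ?_⟩
  rw [hg.constantCoeff_eq, hP0]

lemma isEvenMod_X_pow {k j : ℕ} (hj : Even j) : IsEvenMod k (X ^ j : PowerSeries ℝ) :=
  fun i _ hi ↦ by
    rw [coeff_X_pow, if_neg]
    rintro rfl
    exact (Nat.not_odd_iff_even.2 hj) hi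

variable {ε : ℝ} {B : Set (EuclideanSpace ℝ (Fin m))}

/-- The expansion of a function that is partially even in its first variable, along a curve whose
first component is odd and whose second component is even, up to order `l`. -/
lemma exists_expTo_comp_collar (hε : 0 < ε) (hB : IsOpen B)
    {h : ℝ × EuclideanSpace ℝ (Fin m) → ℝ}
    (hh : ContDiffOn ℝ ∞ h (Ico 0 ε ×ˢ B)) {n : ℕ} (hn : Odd n)
    (he : ∀ w ∈ B, IsEvenMod n (jet (Ico 0 ε ×ˢ B) h w)) {l : ℕ} (hl : 0 < l) (hln : l ≤ n + 1)
    {y : EuclideanSpace ℝ (Fin m)} (hy : y ∈ B)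
    {u : ℝ → ℝ} (hu : ∀ᶠ t in 𝓝[≥] 0, 0 ≤ u t) {V : PowerSeries ℝ} (hV : ExpTo l u (X * V))
    (hVe : IsEvenMod l V)
    {z : ℝ → EuclideanSpace ℝ (Fin m)} (hz0 : z 0 = y) (hzt : ContinuousWithinAt z (Ici 0) 0)
    {p : Fin m → PowerSeries ℝ}
    (hz : ∀ a, ExpTo l (fun t ↦ z t a) (p a)) (hp : ∀ a, IsEvenMod l (p a)) :
    ∃ g, ExpTo l (fun t ↦ h (u t, z t)) g ∧ ∀ i < l, Odd i → coeff i g =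
      if i = n then coeff 0 V ^ n * coeff n (jet (Ico 0 ε ×ˢ B) h y) else 0 := by
  -- The composite is expanded as `∑ u ^ j * c j (z)`.
  set c : ℕ → EuclideanSpace ℝ (Fin m) → ℝ := fun j w ↦ coeff j (jet (Ico 0 ε ×ˢ B) h w) with hcdef
  have hcs : ∀ j, ContDiffAt ℝ ∞ (c j) y := fun j ↦
    (contDiffOn_coeff_jet hε hB hh j).contDiffAt (hB.mem_nhds hy)
  have hzt' : Tendsto z (𝓝[≥] 0) (𝓝 y) := hz0 ▸ hzt
  have hterm : ∀ j, ∃ T, ExpTo l (fun t ↦ u t ^ j * c j (z t)) T ∧ ∀ i < l, Odd i → coeff i T =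
      if j = n then (if i = n then coeff 0 V ^ n * c n y else 0) else 0 := by
    intro j
    -- For odd `j < n` the function `c j` vanishes on all of `B`, hence along the moving point `z
    -- t`. Even `j` give even series. For odd `j ≥ n` the factor `X ^ j` leaves, at orders `i ≤ n`,
    -- only the leading coefficient of the term `j = n`.
    by_cases hj : Odd j ∧ j < n
    · refine ⟨0, ExpTo.zero.congr_fun ?_, fun i _ _ ↦ ?_⟩
      · filter_upwards [hzt' (hB.mem_nhds hy)] with t ht
        simp only [hcdef]
        rw [he _ ht j hj.2 hj.1, mul_zero]
      · rw [if_neg hj.2.ne, map_zero]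
    · obtain ⟨g, hg, hge, hg0⟩ := exists_expTo_comp (hcs j) hl hz0 hz hp
      refine ⟨(X * V) ^ j * g, (hV.pow j).mul hg, fun i hi hio ↦ ?_⟩
      rw [mul_pow, mul_assoc]
      split_ifs with hjn hin
      · subst hjn hin
        have := coeff_X_pow_mul (V ^ i * g) i 0
        rw [zero_add] at this
        rw [this, coeff_zero_mul_eq, hg0]
        simp
      · subst hjn
        rw [coeff_X_pow_mul', if_neg (by omega)]
      · rcases Nat.even_or_odd j with hje | hjo
        · exact (((isEvenMod_X_pow hje).mul ((hVe.pow j).mul hge))) i hi hio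
        · rw [coeff_X_pow_mul', if_neg]
          have : ¬ j < n := fun h ↦ hj ⟨hjo, h⟩
          omega
  choose T hT hTc using hterm
  refine ⟨∑ j ∈ Finset.range l, T j, (ExpTo.sum _ fun j _ ↦ hT j).congr_isBigO ?_, ?_⟩
  -- Since `z t` moves with `t`, the remainder bound must be uniform in the parameter near `y`; `u =
  -- O(t)` then turns `u ^ l` into `t ^ l`.
  · obtain ⟨C, r, hr, hb⟩ := exists_taylor_bound hε hB hh hy l
    have hu0 : (fun t ↦ u t) =O[𝓝[≥] 0] fun t : ℝ ↦ t := by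
      have := (hV.mono (Nat.one_le_iff_ne_zero.2 hl.ne'))
      simpa [ExpTo] using this
    have hut : Tendsto u (𝓝[≥] 0) (𝓝 0) :=
      hu0.trans_tendsto (tendsto_nhdsWithin_of_tendsto_nhds tendsto_id)
    refine IsBigO.trans ?_ (hu0.pow l)
    refine IsBigO.of_bound C ?_
    filter_upwards [hu, hut.eventually_lt_const hr, hzt' (Metric.ball_mem_nhds y hr)]
      with t h1 h2 h3
    rw [Real.norm_eq_abs, Real.norm_eq_abs, abs_of_nonneg (pow_nonneg h1 l)]
    exact hb (u t) ⟨h1, h2⟩ (z t) h3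
  · intro i hi hio
    rw [map_sum, Finset.sum_congr rfl fun j _ ↦ hTc j i hi hio, Finset.sum_ite_eq']
    split_ifs with h1 h2 h2
    · rfl
    · rfl
    · exact absurd (Finset.mem_range.2 (h2 ▸ hi)) h1
    · rfl

end Composition

end AsympHyp

/-! ### The coordinate change between two normal forms -/

namespace AsympHyp

open PowerSeries Filter

section Local

variable {m : ℕ}

/-- Coordinate data of two normal forms of the same metric, `h` with respect to `(x, y)` and `h'`
with respect to `(t, w)`, on `[0, ε) × B`, related by the coordinate change `x = u (t, w)`,
`y = z (t, w)`. -/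
structure CoordChange (ε ε₁ : ℝ) (B B₁ : Set (EuclideanSpace ℝ (Fin m)))
    (u : ℝ × EuclideanSpace ℝ (Fin m) → ℝ)
    (z : ℝ × EuclideanSpace ℝ (Fin m) → EuclideanSpace ℝ (Fin m))
    (h h' : Fin m → Fin m → ℝ × EuclideanSpace ℝ (Fin m) → ℝ) : Prop where
  pos : 0 < ε
  pos₁ : 0 < ε₁
  isOpen : IsOpen B
  isOpen₁ : IsOpen B₁
  u_smooth : ContDiffOn ℝ ∞ u (Ico 0 ε ×ˢ B)
  z_smooth : ContDiffOn ℝ ∞ z (Ico 0 ε ×ˢ B)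
  h_smooth : ∀ a b, ContDiffOn ℝ ∞ (h a b) (Ico 0 ε₁ ×ˢ B₁)
  h'_smooth : ∀ a b, ContDiffOn ℝ ∞ (h' a b) (Ico 0 ε ×ˢ B)
  mapsTo : ∀ p ∈ Ico 0 ε ×ˢ B, (u p, z p) ∈ Ico 0 ε₁ ×ˢ B₁
  u_zero : ∀ w ∈ B, u (0, w) = 0
  u_pos : ∀ p ∈ Ico 0 ε ×ˢ B, 0 < p.1 → 0 < u p
  z_zero : ∀ w ∈ B, z (0, w) = w
  nondegenerate : ∀ w ∈ B, ∀ c : Fin m → ℝ, (∀ b, ∑ a, c a * h a b (0, w) = 0) → c = 0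
  normal_normal : ∀ p ∈ Ico 0 ε ×ˢ B, 0 < p.1 →
    u p ^ 2 = p.1 ^ 2 * (dirDeriv (Ico 0 ε ×ˢ B) (1, 0) u p ^ 2 +
      ∑ a, ∑ b, dirDeriv (Ico 0 ε ×ˢ B) (1, 0) (fun p ↦ z p a) p * h a b (u p, z p) *
        dirDeriv (Ico 0 ε ×ˢ B) (1, 0) (fun p ↦ z p b) p)
  normal_tangential : ∀ p ∈ Ico 0 ε ×ˢ B, 0 < p.1 → ∀ i,
    0 = dirDeriv (Ico 0 ε ×ˢ B) (1, 0) u p *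
        dirDeriv (Ico 0 ε ×ˢ B) (0, EuclideanSpace.single i 1) u p +
      ∑ a, ∑ b, dirDeriv (Ico 0 ε ×ˢ B) (1, 0) (fun p ↦ z p a) p * h a b (u p, z p) *
        dirDeriv (Ico 0 ε ×ˢ B) (0, EuclideanSpace.single i 1) (fun p ↦ z p b) p
  tangential_tangential : ∀ p ∈ Ico 0 ε ×ˢ B, 0 < p.1 → ∀ i j,
    u p ^ 2 * h' i j p = p.1 ^ 2 *
      (dirDeriv (Ico 0 ε ×ˢ B) (0, EuclideanSpace.single i 1) u p *
        dirDeriv (Ico 0 ε ×ˢ B) (0, EuclideanSpace.single j 1) u p +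
      ∑ a, ∑ b, dirDeriv (Ico 0 ε ×ˢ B) (0, EuclideanSpace.single i 1) (fun p ↦ z p a) p *
        h a b (u p, z p) *
        dirDeriv (Ico 0 ε ×ˢ B) (0, EuclideanSpace.single j 1) (fun p ↦ z p b) p)

namespace CoordChange

variable {ε ε₁ : ℝ} {B B₁ : Set (EuclideanSpace ℝ (Fin m))}
  {u : ℝ × EuclideanSpace ℝ (Fin m) → ℝ}
  {z : ℝ × EuclideanSpace ℝ (Fin m) → EuclideanSpace ℝ (Fin m)}
  {h h' : Fin m → Fin m → ℝ × EuclideanSpace ℝ (Fin m) → ℝ}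

lemma comp_smooth (A : CoordChange ε ε₁ B B₁ u z h h') (a : Fin m) :
    ContDiffOn ℝ ∞ (fun p ↦ z p a) (Ico 0 ε ×ˢ B) :=
  contDiffOn_euclidean.1 A.z_smooth a

lemma metric_smooth (A : CoordChange ε ε₁ B B₁ u z h h') (a b : Fin m) :
    ContDiffOn ℝ ∞ (fun p ↦ h a b (u p, z p)) (Ico 0 ε ×ˢ B) :=
  (A.h_smooth a b).comp (A.u_smooth.prodMk A.z_smooth) A.mapsTo

/-- The Taylor series of `u / t`. -/
def quot (ε : ℝ) (B : Set (EuclideanSpace ℝ (Fin m))) (u : ℝ × EuclideanSpace ℝ (Fin m) → ℝ)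
    (w : EuclideanSpace ℝ (Fin m)) : PowerSeries ℝ :=
  PowerSeries.mk fun j ↦ coeff (j + 1) (jet (Ico 0 ε ×ˢ B) u w)

lemma X_mul_quot (A : CoordChange ε ε₁ B B₁ u z h h') {w : EuclideanSpace ℝ (Fin m)}
    (hw : w ∈ B) : X * quot ε B u w = jet (Ico 0 ε ×ˢ B) u w := by
  ext j
  cases j with
  | zero => rw [coeff_zero_X_mul, coeff_zero_jet, A.u_zero w hw]
  | succ j => rw [coeff_succ_X_mul, quot, coeff_mk]

lemma zero_mem (A : CoordChange ε ε₁ B B₁ u z h h') {w : EuclideanSpace ℝ (Fin m)}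
    (hw : w ∈ B) : ((0 : ℝ), w) ∈ Ico 0 ε ×ˢ B := ⟨⟨le_rfl, A.pos⟩, hw⟩

lemma mem_B₁ (A : CoordChange ε ε₁ B B₁ u z h h') {w : EuclideanSpace ℝ (Fin m)}
    (hw : w ∈ B) : w ∈ B₁ := by
  simpa [A.z_zero w hw] using (A.mapsTo _ (A.zero_mem hw)).2

lemma expTo (A : CoordChange ε ε₁ B B₁ u z h h') {w : EuclideanSpace ℝ (Fin m)}
    (hw : w ∈ B) {F : ℝ × EuclideanSpace ℝ (Fin m) → ℝ} (hF : ContDiffOn ℝ ∞ F (Ico 0 ε ×ˢ B))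
    (K : ℕ) : ExpTo K (fun t ↦ F (t, w)) (jet (Ico 0 ε ×ˢ B) F w) :=
  expTo_jet A.pos A.isOpen hF hw K

/-- The metric identities are known only for `t > 0`, while the expansions include `t = 0`; equality
there is supplied separately. -/
lemma series_eq (A : CoordChange ε ε₁ B B₁ u z h h') {f g : ℝ → ℝ} {p q : PowerSeries ℝ}
    (hf : ∀ K, ExpTo K f p) (hg : ∀ K, ExpTo K g q) (h0 : f 0 = g 0)
    (hpos : ∀ t, 0 < t → t < ε → f t = g t) : p = q := by
  refine ExpTo.ext hf fun K ↦ (hg K).congr_fun ?_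
  filter_upwards [Ico_mem_nhdsGE A.pos] with t ht
  rcases ht.1.eq_or_lt with rfl | h1
  · exact h0.symm
  · exact (hpos t h1 ht.2).symm

lemma jet_normal_normal (A : CoordChange ε ε₁ B B₁ u z h h') {w : EuclideanSpace ℝ (Fin m)}
    (hw : w ∈ B) :
    (X * quot ε B u w) ^ 2 = X ^ 2 * (PowerSeries.derivative ℝ (X * quot ε B u w) ^ 2 +
      ∑ a, ∑ b, PowerSeries.derivative ℝ (jet (Ico 0 ε ×ˢ B) (fun p ↦ z p a) w) *
        jet (Ico 0 ε ×ˢ B) (fun p ↦ h a b (u p, z p)) w *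
        PowerSeries.derivative ℝ (jet (Ico 0 ε ×ˢ B) (fun p ↦ z p b) w)) := by
  rw [A.X_mul_quot hw]
  simp only [← jet_dirDeriv]
  have hd := fun {F} (hF : ContDiffOn ℝ ∞ F (Ico 0 ε ×ˢ B)) ↦
    contDiffOn_dirDeriv A.isOpen hF (1, 0)
  refine A.series_eq (fun K ↦ (A.expTo hw A.u_smooth K).pow 2)
    (fun K ↦ (ExpTo.id.pow 2).mul (((A.expTo hw (hd A.u_smooth) K).pow 2).add
      (ExpTo.sum _ fun a _ ↦ ExpTo.sum _ fun b _ ↦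
        ((A.expTo hw (hd (A.comp_smooth a)) K).mul (A.expTo hw (A.metric_smooth a b) K)).mul
          (A.expTo hw (hd (A.comp_smooth b)) K)))) ?_ ?_
  · simp [A.u_zero w hw]
  · intro t h0 h1
    exact A.normal_normal (t, w) ⟨⟨h0.le, h1⟩, hw⟩ h0

lemma jet_normal_tangential (A : CoordChange ε ε₁ B B₁ u z h h') {w : EuclideanSpace ℝ (Fin m)}
    (hw : w ∈ B) (i : Fin m) :
    0 = PowerSeries.derivative ℝ (jet (Ico 0 ε ×ˢ B) u w) *
        jet (Ico 0 ε ×ˢ B) (dirDeriv (Ico 0 ε ×ˢ B) (0, EuclideanSpace.single i 1) u) w +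
      ∑ a, ∑ b, PowerSeries.derivative ℝ (jet (Ico 0 ε ×ˢ B) (fun p ↦ z p a) w) *
        jet (Ico 0 ε ×ˢ B) (fun p ↦ h a b (u p, z p)) w *
        jet (Ico 0 ε ×ˢ B) (dirDeriv (Ico 0 ε ×ˢ B) (0, EuclideanSpace.single i 1)
          (fun p ↦ z p b)) w := by
  simp only [← jet_dirDeriv]
  have hd := fun {F} (hF : ContDiffOn ℝ ∞ F (Ico 0 ε ×ˢ B)) ↦ contDiffOn_dirDeriv A.isOpen hF
  -- Multiplying by `t` makes both sides vanish at `t = 0`, where the identity is not given.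
  refine mul_left_cancel₀ (X_ne_zero (R := ℝ)) ?_
  rw [mul_zero]
  refine A.series_eq (fun K ↦ ExpTo.zero) (fun K ↦ ExpTo.id.mul
    (((A.expTo hw (hd A.u_smooth _) K).mul (A.expTo hw (hd A.u_smooth _) K)).add
      (ExpTo.sum _ fun a _ ↦ ExpTo.sum _ fun b _ ↦
        ((A.expTo hw (hd (A.comp_smooth a) _) K).mul (A.expTo hw (A.metric_smooth a b) K)).mul
          (A.expTo hw (hd (A.comp_smooth b) _) K)))) ?_ ?_
  · simp
  · intro t h0 h1
    rw [← A.normal_tangential (t, w) ⟨⟨h0.le, h1⟩, hw⟩ h0 i, mul_zero]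

lemma jet_tangential_tangential (A : CoordChange ε ε₁ B B₁ u z h h')
    {w : EuclideanSpace ℝ (Fin m)} (hw : w ∈ B) (i j : Fin m) :
    (X * quot ε B u w) ^ 2 * jet (Ico 0 ε ×ˢ B) (h' i j) w = X ^ 2 *
      (jet (Ico 0 ε ×ˢ B) (dirDeriv (Ico 0 ε ×ˢ B) (0, EuclideanSpace.single i 1) u) w *
        jet (Ico 0 ε ×ˢ B) (dirDeriv (Ico 0 ε ×ˢ B) (0, EuclideanSpace.single j 1) u) w +
      ∑ a, ∑ b, jet (Ico 0 ε ×ˢ B) (dirDeriv (Ico 0 ε ×ˢ B) (0, EuclideanSpace.single i 1)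
          (fun p ↦ z p a)) w *
        jet (Ico 0 ε ×ˢ B) (fun p ↦ h a b (u p, z p)) w *
        jet (Ico 0 ε ×ˢ B) (dirDeriv (Ico 0 ε ×ˢ B) (0, EuclideanSpace.single j 1)
          (fun p ↦ z p b)) w) := by
  rw [A.X_mul_quot hw]
  have hd := fun {F} (hF : ContDiffOn ℝ ∞ F (Ico 0 ε ×ˢ B)) ↦ contDiffOn_dirDeriv A.isOpen hF
  refine A.series_eq
    (fun K ↦ ((A.expTo hw A.u_smooth K).pow 2).mul (A.expTo hw (A.h'_smooth i j) K))
    (fun K ↦ (ExpTo.id.pow 2).mul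
    (((A.expTo hw (hd A.u_smooth _) K).mul (A.expTo hw (hd A.u_smooth _) K)).add
      (ExpTo.sum _ fun a _ ↦ ExpTo.sum _ fun b _ ↦
        ((A.expTo hw (hd (A.comp_smooth a) _) K).mul (A.expTo hw (A.metric_smooth a b) K)).mul
          (A.expTo hw (hd (A.comp_smooth b) _) K)))) ?_ ?_
  · simp [A.u_zero w hw]
  · intro t h0 h1
    exact A.tangential_tangential (t, w) ⟨⟨h0.le, h1⟩, hw⟩ h0 i j

lemma coeff_zero_jet_tangential_u (A : CoordChange ε ε₁ B B₁ u z h h')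
    {w : EuclideanSpace ℝ (Fin m)} (hw : w ∈ B) (v : EuclideanSpace ℝ (Fin m)) :
    coeff 0 (jet (Ico 0 ε ×ˢ B) (dirDeriv (Ico 0 ε ×ˢ B) (0, v) u) w) = 0 := by
  rw [coeff_zero_jet, dirDeriv_zero_slice A.pos A.isOpen A.u_smooth hw (L := 0) (c := 0)]
  · simp
  · intro w hw; simp [A.u_zero w hw]

lemma coeff_zero_jet_tangential_z (A : CoordChange ε ε₁ B B₁ u z h h')
    {w : EuclideanSpace ℝ (Fin m)} (hw : w ∈ B) (a i : Fin m) :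
    coeff 0 (jet (Ico 0 ε ×ˢ B) (dirDeriv (Ico 0 ε ×ˢ B) (0, EuclideanSpace.single i 1)
      (fun p ↦ z p a)) w) = if a = i then 1 else 0 := by
  rw [coeff_zero_jet, dirDeriv_zero_slice A.pos A.isOpen (A.comp_smooth a) hw
    (L := EuclideanSpace.proj a) (c := 0)]
  · simp
  · intro w hw; simp [A.z_zero w hw]

lemma coeff_zero_jet_metric (A : CoordChange ε ε₁ B B₁ u z h h')
    {w : EuclideanSpace ℝ (Fin m)} (hw : w ∈ B) (a b : Fin m) :
    coeff 0 (jet (Ico 0 ε ×ˢ B) (fun p ↦ h a b (u p, z p)) w) = h a b (0, w) := by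
  rw [coeff_zero_jet, A.u_zero w hw, A.z_zero w hw]

/-- If `u / t` vanished at the boundary, the tangential identity at order 0 would give `h₀ = 0`,
contradicting nondegeneracy in positive boundary dimension. -/
lemma coeff_zero_quot_ne_zero [Nonempty (Fin m)] (A : CoordChange ε ε₁ B B₁ u z h h')
    {w : EuclideanSpace ℝ (Fin m)} (hw : w ∈ B) : coeff 0 (quot ε B u w) ≠ 0 := by
  intro h0
  have h1 : ∀ i j, h i j (0, w) = 0 := by
    intro i j
    have h2 := A.jet_tangential_tangential hw i j
    rw [mul_pow, mul_assoc] at h2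
    have h3 := congrArg (coeff 0) (mul_left_cancel₀ (pow_ne_zero 2 (X_ne_zero (R := ℝ))) h2)
    simp only [map_add, map_sum, coeff_zero_mul_eq, A.coeff_zero_jet_tangential_u hw,
      A.coeff_zero_jet_tangential_z hw, A.coeff_zero_jet_metric hw, pow_two, h0] at h3
    simpa using h3.symm
  have h4 := A.nondegenerate w hw (fun _ ↦ 1) (by simp [h1])
  exact one_ne_zero (congrFun h4 (Classical.arbitrary _))

/-- Since `u ≥ 0`, a negative slope would be dominated by the remainder: `|t V₀| ≤ |u - t V₀| =
O(t²)`, forcing `V₀ = 0`. -/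
lemma coeff_zero_quot_pos [Nonempty (Fin m)] (A : CoordChange ε ε₁ B B₁ u z h h')
    {w : EuclideanSpace ℝ (Fin m)} (hw : w ∈ B) : 0 < coeff 0 (quot ε B u w) := by
  refine lt_of_le_of_ne ?_ (A.coeff_zero_quot_ne_zero hw).symm
  by_contra hneg
  push Not at hneg
  refine hneg.ne (ExpTo.coeff_eq_zero_of_pow (j := 1) ?_)
  have h1 := A.expTo hw A.u_smooth 2
  rw [← A.X_mul_quot hw] at h1
  refine IsBigO.trans (IsBigO.of_bound 1 ?_) h1
  filter_upwards [Ico_mem_nhdsGE A.pos] with t ht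
  have hu : 0 ≤ u (t, w) := by
    rcases ht.1.eq_or_lt with rfl | h1
    · rw [A.u_zero w hw]
    · exact (A.u_pos _ ⟨ht, hw⟩ h1).le
  have h2 : t ^ 1 * coeff 0 (quot ε B u w) ≤ 0 := by
    rw [pow_one]; exact mul_nonpos_of_nonneg_of_nonpos ht.1 hneg.le
  simp only [Finset.sum_range_succ, Finset.sum_range_zero, coeff_zero_X_mul, coeff_succ_X_mul,
    mul_zero, zero_add, one_mul, Real.norm_eq_abs]
  rw [abs_of_nonpos h2, abs_of_nonneg (by linarith)]
  linarith

/-- Used with `l ≤ n` inside the recursion, where the exceptional case is out of range, and with `l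
= n + 1` at the end, where it produces the factor `αⁿ`. -/
lemma jet_metric_parity (A : CoordChange ε ε₁ B B₁ u z h h') {n : ℕ} (hn : Odd n)
    (he : ∀ a b, ∀ w ∈ B₁, IsEvenMod n (jet (Ico 0 ε₁ ×ˢ B₁) (h a b) w)) {l : ℕ} (hl : 0 < l)
    (hln : l ≤ n + 1) {w : EuclideanSpace ℝ (Fin m)} (hw : w ∈ B)
    (hV : IsEvenMod l (quot ε B u w))
    (hZ : ∀ a, IsEvenMod l (jet (Ico 0 ε ×ˢ B) (fun p ↦ z p a) w)) (a b : Fin m) :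
    ∀ i < l, Odd i → coeff i (jet (Ico 0 ε ×ˢ B) (fun p ↦ h a b (u p, z p)) w) =
      if i = n then coeff 0 (quot ε B u w) ^ n * coeff n (jet (Ico 0 ε₁ ×ˢ B₁) (h a b) w)
        else 0 := by
  have hmem : MapsTo (fun t : ℝ ↦ (t, w)) (Ico 0 ε) (Ico 0 ε ×ˢ B) := fun t ht ↦ ⟨ht, hw⟩
  have hzc : ContinuousWithinAt (fun t : ℝ ↦ z (t, w)) (Ici 0) 0 := by
    have h1 := (A.z_smooth.continuousOn.comp
      (Continuous.continuousOn (by fun_prop : Continuous fun t : ℝ ↦ (t, w))) hmem) 0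
      ⟨le_rfl, A.pos⟩
    exact h1.mono_of_mem_nhdsWithin (Ico_mem_nhdsGE A.pos)
  obtain ⟨g, hg, hgc⟩ := exists_expTo_comp_collar (u := fun t ↦ u (t, w)) (z := fun t ↦ z (t, w))
    A.pos₁ A.isOpen₁ (A.h_smooth a b) hn (he a b) hl hln (A.mem_B₁ hw) (by
      filter_upwards [Ico_mem_nhdsGE A.pos] with t ht
      exact (A.mapsTo (t, w) ⟨ht, hw⟩).1.1)
    (by rw [A.X_mul_quot hw]; exact A.expTo hw A.u_smooth l) hV (A.z_zero w hw) hzc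
    (fun a ↦ A.expTo hw (A.comp_smooth a) l) hZ
  intro i hi hio
  rw [← hgc i hi hio]
  exact (A.expTo hw (A.metric_smooth a b) l).unique hg i hi

/-- Tangential derivatives preserve the parity of jets. -/
lemma isEvenMod_tangential (A : CoordChange ε ε₁ B B₁ u z h h') {k : ℕ}
    {F : ℝ × EuclideanSpace ℝ (Fin m) → ℝ} (hF : ContDiffOn ℝ ∞ F (Ico 0 ε ×ˢ B))
    (he : ∀ w ∈ B, IsEvenMod k (jet (Ico 0 ε ×ˢ B) F w)) {w : EuclideanSpace ℝ (Fin m)}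
    (hw : w ∈ B) (v : EuclideanSpace ℝ (Fin m)) :
    IsEvenMod k (jet (Ico 0 ε ×ˢ B) (dirDeriv (Ico 0 ε ×ˢ B) (0, v) F) w) := fun j hj ho ↦
  coeff_jet_tangential_eq_zero A.pos A.isOpen hF (fun w hw ↦ he w hw j hj ho) hw v

lemma isOddMod_tangential (A : CoordChange ε ε₁ B B₁ u z h h') {k : ℕ}
    {F : ℝ × EuclideanSpace ℝ (Fin m) → ℝ} (hF : ContDiffOn ℝ ∞ F (Ico 0 ε ×ˢ B))
    (he : ∀ w ∈ B, IsOddMod k (jet (Ico 0 ε ×ˢ B) F w)) {w : EuclideanSpace ℝ (Fin m)}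
    (hw : w ∈ B) (v : EuclideanSpace ℝ (Fin m)) :
    IsOddMod k (jet (Ico 0 ε ×ˢ B) (dirDeriv (Ico 0 ε ×ˢ B) (0, v) F) w) := fun j hj ho ↦
  coeff_jet_tangential_eq_zero A.pos A.isOpen hF (fun w hw ↦ he w hw j hj ho) hw v

lemma isOddMod_u (A : CoordChange ε ε₁ B B₁ u z h h') {k : ℕ}
    (hV : ∀ w ∈ B, IsEvenMod k (quot ε B u w)) :
    ∀ w ∈ B, IsOddMod (k + 1) (jet (Ico 0 ε ×ˢ B) u w) := fun w hw ↦ by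
  rw [← A.X_mul_quot hw]
  exact (hV w hw).X_mul

/-- The coordinate change is even in `t`, up to order `n + 2`. -/
lemma parity [Nonempty (Fin m)] (A : CoordChange ε ε₁ B B₁ u z h h') {n : ℕ} (hn : Odd n)
    (he : ∀ a b, ∀ w ∈ B₁, IsEvenMod n (jet (Ico 0 ε₁ ×ˢ B₁) (h a b) w)) (r : ℕ)
    (hr : 2 * r ≤ n + 1) :
    (∀ w ∈ B, ∀ a, IsEvenMod (2 * r + 1) (jet (Ico 0 ε ×ˢ B) (fun p ↦ z p a) w)) ∧
      ∀ w ∈ B, IsEvenMod (2 * r + 1) (quot ε B u w) := by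
  induction r with
  | zero =>
    have h1 : ∀ f, IsEvenMod (2 * 0 + 1) f := fun f j hj ho ↦ by
      obtain rfl : j = 0 := by omega
      exact absurd ho (by decide)
    exact ⟨fun _ _ _ ↦ h1 _, fun _ _ ↦ h1 _⟩
  | succ r ih =>
    obtain ⟨hZ, hV⟩ := ih (by omega)
    set k := 2 * r + 1 with hk
    have hko : Odd k := ⟨r, rfl⟩
    have hkn : k ≤ n := by omega
    have hH : ∀ w ∈ B, ∀ a b,
        IsEvenMod k (jet (Ico 0 ε ×ˢ B) (fun p ↦ h a b (u p, z p)) w) := fun w hw a b i hi hio ↦ by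
      rw [A.jet_metric_parity hn he (by omega) (by omega) hw (hV w hw) (hZ w hw) a b i hi hio,
        if_neg (by omega)]
    have hU := A.isOddMod_u hV
    -- The boundary components come first, as the step for `u / t` needs them two orders ahead.
    -- Parity is carried for all `w ∈ B` at once, since tangential derivatives are taken.
    have hZ' : ∀ w ∈ B, ∀ a, IsEvenMod (k + 2) (jet (Ico 0 ε ×ˢ B) (fun p ↦ z p a) w) :=
      fun w hw ↦ isEvenMod_boundary_step hko (hZ w hw) (hU w hw) (hH w hw)
        (fun a i ↦ A.isEvenMod_tangential (A.comp_smooth a) (fun w hw ↦ hZ w hw a) hw _)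
        (fun i ↦ (A.isOddMod_tangential A.u_smooth hU hw _).mono (Nat.le_succ k))
        (A.coeff_zero_jet_tangential_z hw)
        (fun c hc ↦ A.nondegenerate w hw c fun b ↦ by
          simpa only [A.coeff_zero_jet_metric hw] using hc b)
        (A.jet_normal_tangential hw)
    exact ⟨hZ', fun w hw ↦ isEvenMod_defining_step hko (hZ' w hw) (hV w hw)
      (A.coeff_zero_quot_ne_zero hw) (hH w hw) (A.jet_normal_normal hw)⟩

/-- Partial evenness is preserved, and the coefficient of order `n` is rescaled. -/
theorem coeff_transform [Nonempty (Fin m)] (A : CoordChange ε ε₁ B B₁ u z h h') {n : ℕ}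
    (hn : Odd n) (he : ∀ a b, ∀ w ∈ B₁, IsEvenMod n (jet (Ico 0 ε₁ ×ˢ B₁) (h a b) w))
    {w : EuclideanSpace ℝ (Fin m)} (hw : w ∈ B) :
    ∃ α : ℝ, 0 < α ∧ ∀ i j, IsEvenMod n (jet (Ico 0 ε ×ˢ B) (h' i j) w) ∧
      α ^ 2 * h' i j (0, w) = h i j (0, w) ∧
      α ^ 2 * coeff n (jet (Ico 0 ε ×ˢ B) (h' i j) w) =
        α ^ n * coeff n (jet (Ico 0 ε₁ ×ˢ B₁) (h i j) w) := by
  obtain ⟨r, hr⟩ := hn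
  obtain ⟨hZ, hV⟩ := A.parity ⟨r, hr⟩ he (r + 1) (by omega)
  have hle : n + 1 ≤ 2 * (r + 1) + 1 := by omega
  have hpar := fun a b ↦ A.jet_metric_parity ⟨r, hr⟩ he (Nat.succ_pos n) le_rfl hw
    ((hV w hw).mono hle) (fun a ↦ (hZ w hw a).mono hle) a b
  -- Here `α` is the value of `u / t` at the boundary.
  refine ⟨_, A.coeff_zero_quot_pos hw, fun i j ↦ ?_⟩
  obtain ⟨h1, h2, h3⟩ := AsympHyp.isEvenMod_tangential ⟨r, hr⟩ ((hV w hw).mono hle)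
    (A.coeff_zero_quot_ne_zero hw)
    (fun a b i hi hio ↦ by rw [hpar a b i (by omega) hio, if_neg (by omega)])
    (fun a i ↦ (A.isEvenMod_tangential (A.comp_smooth a) (fun w hw ↦ hZ w hw a) hw
      (EuclideanSpace.single i 1)).mono hle)
    (fun i ↦ (A.isOddMod_tangential A.u_smooth (A.isOddMod_u hV) hw
      (EuclideanSpace.single i 1)).mono (by omega))
    (fun i ↦ A.coeff_zero_jet_tangential_u hw _) (A.coeff_zero_jet_tangential_z hw)
    (A.jet_tangential_tangential hw) i j
  rw [A.coeff_zero_jet_metric hw, coeff_zero_jet] at h2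
  refine ⟨h1, h2, ?_⟩
  rw [h3, hpar i j n (Nat.lt_succ_self n) ⟨r, hr⟩, if_pos rfl]

end CoordChange

end Local

end AsympHyp

/-! ### Charts of the boundary and components of the metric family -/

namespace AsympHyp

open Filter

section ChartFrame

variable {m : ℕ} {N : Type*} [TopologicalSpace N] [ChartedSpace (EuclideanSpace ℝ (Fin m)) N]

/-- The differential of the inverse of the preferred chart at `q`. -/
def chartFrame (q : N) (w : EuclideanSpace ℝ (Fin m)) :
    EuclideanSpace ℝ (Fin m) →L[ℝ] TangentSpace (𝓡 m) ((extChartAt (𝓡 m) q).symm w) :=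
  mfderiv 𝓘(ℝ, EuclideanSpace ℝ (Fin m)) (𝓡 m) (extChartAt (𝓡 m) q).symm w

/-- The components of a family of bilinear forms on `N` in the preferred chart at `q`. -/
def metricCoord (h : ℝ → ∀ q : N, TangentSpace (𝓡 m) q →L[ℝ] TangentSpace (𝓡 m) q →L[ℝ] ℝ)
    (q : N) (a b : Fin m) (p : ℝ × EuclideanSpace ℝ (Fin m)) : ℝ :=
  h p.1 ((extChartAt (𝓡 m) q).symm p.2) (chartFrame q p.2 (EuclideanSpace.single a 1))
    (chartFrame q p.2 (EuclideanSpace.single b 1))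

lemma form_frame_expand
    (h : ℝ → ∀ q : N, TangentSpace (𝓡 m) q →L[ℝ] TangentSpace (𝓡 m) q →L[ℝ] ℝ)
    (q : N) (t : ℝ) (w v₁ v₂ : EuclideanSpace ℝ (Fin m)) :
    h t ((extChartAt (𝓡 m) q).symm w) (chartFrame q w v₁) (chartFrame q w v₂) =
      ∑ a, ∑ b, v₁ a * metricCoord h q a b (t, w) * v₂ b := by
  have hsum : ∀ v : EuclideanSpace ℝ (Fin m),
      v = ∑ a, v a • EuclideanSpace.single a (1 : ℝ) := fun v ↦ by
    ext i
    simp [Pi.single_apply]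
  conv_lhs => rw [hsum v₁, hsum v₂]
  simp only [map_sum, map_smul, sum_apply, smul_apply, smul_eq_mul, metricCoord]
  rw [Finset.sum_comm]
  refine Finset.sum_congr rfl fun a _ ↦ ?_
  simp only [Finset.mul_sum]
  exact Finset.sum_congr rfl fun b _ ↦ by ring

variable [IsManifold (𝓡 m) ∞ N]

lemma mdifferentiableAt_chart_symm (q : N) {w : EuclideanSpace ℝ (Fin m)}
    (hw : w ∈ (extChartAt (𝓡 m) q).target) :
    MDifferentiableAt 𝓘(ℝ, EuclideanSpace ℝ (Fin m)) (𝓡 m) (extChartAt (𝓡 m) q).symm w :=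
  ((contMDiffOn_extChartAt_symm (n := ∞) q).contMDiffAt
    ((isOpen_extChartAt_target q).mem_nhds hw)).mdifferentiableAt (by simp)

lemma isInvertible_chartFrame (q : N) {w : EuclideanSpace ℝ (Fin m)}
    (hw : w ∈ (extChartAt (𝓡 m) q).target) : (chartFrame q w).IsInvertible := by
  have : IsManifold (𝓡 m) 1 N := IsManifold.of_le (n := ∞) (by simp)
  have := isInvertible_mfderivWithin_extChartAt_symm hw
  rwa [ModelWithCorners.range_eq_univ, mfderivWithin_univ] at this

lemma contMDiffOn_chartFrame (q : N) (v : EuclideanSpace ℝ (Fin m)) :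
    ContMDiffOn 𝓘(ℝ, EuclideanSpace ℝ (Fin m)) (𝓡 m).tangent ∞
      (fun w ↦ (TotalSpace.mk' (EuclideanSpace ℝ (Fin m)) ((extChartAt (𝓡 m) q).symm w)
        (chartFrame q w v) : TangentBundle (𝓡 m) N)) (extChartAt (𝓡 m) q).target := by
  have : IsManifold (𝓡 m) 1 N := IsManifold.of_le (n := ∞) (by simp)
  have ho : IsOpen (extChartAt (𝓡 m) q).target := isOpen_extChartAt_target q
  have h1 := (contMDiffOn_extChartAt_symm (I := 𝓡 m) (n := ∞) q).contMDiffOn_tangentMapWithin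
    (m := ∞) (by simp) ho.uniqueMDiffOn
  have h2 := contMDiffOn_vectorSpace_iff_contDiffOn (𝕜 := ℝ) (n := ∞)
    (V := fun _ : EuclideanSpace ℝ (Fin m) ↦ v) (s := (extChartAt (𝓡 m) q).target) |>.2
    contDiffOn_const
  refine (h1.comp h2 fun w hw ↦ hw).congr fun w hw ↦ ?_
  simp only [Function.comp, tangentMapWithin, chartFrame, mfderivWithin_of_isOpen ho hw]
  rfl

/-- The map `(t, w) ↦ (t, φ⁻¹ w)` for the preferred chart `φ` at `q`. -/
def chartProd (q : N) (p : ℝ × EuclideanSpace ℝ (Fin m)) : ℝ × N :=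
  (p.1, (extChartAt (𝓡 m) q).symm p.2)

lemma contMDiffOn_chartProd (q : N) :
    ContMDiffOn 𝓘(ℝ, ℝ × EuclideanSpace ℝ (Fin m)) (𝓘(ℝ, ℝ).prod (𝓡 m)) ∞ (chartProd q)
      {p | p.2 ∈ (extChartAt (𝓡 m) q).target} := by
  refine ContMDiffOn.prodMk contDiff_fst.contMDiff.contMDiffOn ?_
  exact (contMDiffOn_extChartAt_symm q).comp contDiff_snd.contMDiff.contMDiffOn fun p hp ↦ hp

lemma contDiffOn_metricCoord
    {h : ℝ → ∀ q : N, TangentSpace (𝓡 m) q →L[ℝ] TangentSpace (𝓡 m) q →L[ℝ] ℝ}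
    {D : Set (ℝ × N)}
    (hh : ContMDiffOn (𝓘(ℝ, ℝ).prod (𝓡 m))
      ((𝓡 m).prod 𝓘(ℝ, EuclideanSpace ℝ (Fin m) →L[ℝ] EuclideanSpace ℝ (Fin m) →L[ℝ] ℝ)) ∞
      (fun z : ℝ × N ↦ (TotalSpace.mk z.2 (h z.1 z.2) :
        TotalSpace (EuclideanSpace ℝ (Fin m) →L[ℝ] EuclideanSpace ℝ (Fin m) →L[ℝ] ℝ)
          fun q : N ↦ TangentSpace (𝓡 m) q →L[ℝ] TangentSpace (𝓡 m) q →L[ℝ] ℝ)) D)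
    (q : N) (a b : Fin m) {s : Set (ℝ × EuclideanSpace ℝ (Fin m))}
    (hs : ∀ p ∈ s, p.2 ∈ (extChartAt (𝓡 m) q).target ∧ chartProd q p ∈ D) :
    ContDiffOn ℝ ∞ (metricCoord h q a b) s := by
  have : IsManifold (𝓡 m) 1 N := IsManifold.of_le (n := ∞) (by simp)
  have h1 := hh.comp ((contMDiffOn_chartProd q).mono fun p hp ↦ (hs p hp).1) fun p hp ↦ (hs p hp).2
  have hv : ∀ v, ContMDiffOn 𝓘(ℝ, ℝ × EuclideanSpace ℝ (Fin m)) (𝓡 m).tangent ∞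
      (fun p : ℝ × EuclideanSpace ℝ (Fin m) ↦
        (TotalSpace.mk' (EuclideanSpace ℝ (Fin m)) ((extChartAt (𝓡 m) q).symm p.2)
        (chartFrame q p.2 v) : TangentBundle (𝓡 m) N)) s := fun v ↦
    (contMDiffOn_chartFrame q v).comp contDiff_snd.contMDiff.contMDiffOn fun p hp ↦ (hs p hp).1
  -- Evaluating the smooth family on two smooth frame fields gives a map into the trivial line
  -- bundle, whose fibre part is the component.
  have h2 : ContMDiffOn 𝓘(ℝ, ℝ × EuclideanSpace ℝ (Fin m)) ((𝓡 m).prod 𝓘(ℝ, ℝ)) ∞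
      (fun p : ℝ × EuclideanSpace ℝ (Fin m) ↦
        (TotalSpace.mk' ℝ (E := Bundle.Trivial N ℝ) ((extChartAt (𝓡 m) q).symm p.2)
          (metricCoord h q a b p))) s := by
    refine ContMDiffOn.clm_bundle_apply₂ (F₁ := EuclideanSpace ℝ (Fin m))
      (F₂ := EuclideanSpace ℝ (Fin m)) (F₃ := ℝ) ?_ (hv _) (hv _)
    exact h1
  rw [← contMDiffOn_iff_contDiffOn]
  intro p hp
  have h3 := h2 p hp
  simp only [contMDiffWithinAt_totalSpace] at h3
  exact h3.2

lemma tendsto_chartProd (q : N) :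
    Tendsto (chartProd q) (𝓝 ((0 : ℝ), extChartAt (𝓡 m) q q)) (𝓝 (0, q)) := by
  have h := ((contMDiffOn_chartProd q).contMDiffAt (x := ((0 : ℝ), extChartAt (𝓡 m) q q))
    (((isOpen_extChartAt_target q).preimage continuous_snd).mem_nhds
      (mem_extChartAt_target q))).continuousAt.tendsto
  have h2 : chartProd q ((0 : ℝ), extChartAt (𝓡 m) q q) = (0, q) := by
    simp [chartProd]
  rwa [h2] at h

end ChartFrame

end AsympHyp

/-! ### Pulling the normal form back to coordinates -/

namespace AsympHyp

open Filter

section Pullback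

/-- Equal base points still give distinct tangent space types; vectors are compared in the common
model space to avoid transport. -/
lemma form_congr {m : ℕ} {N : Type*} [TopologicalSpace N]
    [ChartedSpace (EuclideanSpace ℝ (Fin m)) N]
    {h : ℝ → ∀ q : N, TangentSpace (𝓡 m) q →L[ℝ] TangentSpace (𝓡 m) q →L[ℝ] ℝ}
    {t₁ t₂ : ℝ} (ht : t₁ = t₂) {q₁ q₂ : N} (hq : q₁ = q₂)
    {v₁ w₁ v₂ w₂ : EuclideanSpace ℝ (Fin m)} (hv : v₁ = v₂) (hw : w₁ = w₂) :
    h t₁ q₁ v₁ w₁ = h t₂ q₂ v₂ w₂ := by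
  subst ht hq hv hw
  rfl

variable {n : ℕ} [NeZero n] {M : Type*} [TopologicalSpace M]
  [ChartedSpace (EuclideanHalfSpace n) M] [IsManifold (𝓡∂ n) ∞ M]
  {N : Type*} [TopologicalSpace N] [ChartedSpace (EuclideanSpace ℝ (Fin (n - 1))) N]
  [IsManifold (𝓡 (n - 1)) ∞ N] {g : InteriorMetric n M} {ι : N → M} {x : M → ℝ}

/-- The metric in normal form, pulled back to a coordinate domain. -/
lemma NormalForm.metric_pullback (S : NormalForm g ι x) (hx : ContMDiff (𝓡∂ n) 𝓘(ℝ, ℝ) ∞ x)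
    {G : ℝ × EuclideanSpace ℝ (Fin (n - 1)) → M} {p : ℝ × EuclideanSpace ℝ (Fin (n - 1))}
    (hG : MDifferentiableAt 𝓘(ℝ, ℝ × EuclideanSpace ℝ (Fin (n - 1))) (𝓡∂ n) G p)
    (hGs : G p ∈ S.source) (hGi : G p ∈ (𝓡∂ n).interior M)
    {υ : ℝ × EuclideanSpace ℝ (Fin (n - 1)) → ℝ} (hυ : (fun r ↦ x (G r)) =ᶠ[𝓝 p] υ)
    {ζ : ℝ × EuclideanSpace ℝ (Fin (n - 1)) → EuclideanSpace ℝ (Fin (n - 1))}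
    (hζd : DifferentiableAt ℝ ζ p) (q : N) (hζt : ζ p ∈ (extChartAt (𝓡 (n - 1)) q).target)
    (hζ : (fun r ↦ S.proj (G r)) =ᶠ[𝓝 p] fun r ↦ (extChartAt (𝓡 (n - 1)) q).symm (ζ r))
    (V W : ℝ × EuclideanSpace ℝ (Fin (n - 1))) :
    g.inner (G p) (mfderiv 𝓘(ℝ, ℝ × EuclideanSpace ℝ (Fin (n - 1))) (𝓡∂ n) G p V)
      (mfderiv 𝓘(ℝ, ℝ × EuclideanSpace ℝ (Fin (n - 1))) (𝓡∂ n) G p W) =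
    (υ p ^ 2)⁻¹ * (fderiv ℝ υ p V * fderiv ℝ υ p W +
      S.h (υ p) ((extChartAt (𝓡 (n - 1)) q).symm (ζ p)) (chartFrame q (ζ p) (fderiv ℝ ζ p V))
        (chartFrame q (ζ p) (fderiv ℝ ζ p W))) := by
  have hx1 : ∀ V : ℝ × EuclideanSpace ℝ (Fin (n - 1)),
      diff x (G p) (mfderiv 𝓘(ℝ, ℝ × EuclideanSpace ℝ (Fin (n - 1))) (𝓡∂ n) G p V) =
        fderiv ℝ υ p V := by
    intro V
    have h1 := mfderiv_comp p (hx.mdifferentiableAt (by simp) (x := G p)) hG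
    have h2 : mfderiv 𝓘(ℝ, ℝ × EuclideanSpace ℝ (Fin (n - 1))) 𝓘(ℝ, ℝ) (x ∘ G) p =
      mfderiv 𝓘(ℝ, ℝ × EuclideanSpace ℝ (Fin (n - 1))) 𝓘(ℝ, ℝ) υ p := EventuallyEq.mfderiv_eq hυ
    rw [mfderiv_eq_fderiv (f := υ)] at h2
    exact (DFunLike.congr_fun (h1.symm.trans h2) V)
  have hp1 : MDifferentiableAt (𝓡∂ n) (𝓡 (n - 1)) S.proj (G p) :=
    (S.proj_smooth.contMDiffAt (S.isOpen_source.mem_nhds hGs)).mdifferentiableAt (by simp)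
  have hp : ∀ V : ℝ × EuclideanSpace ℝ (Fin (n - 1)),
      (mfderiv (𝓡∂ n) (𝓡 (n - 1)) S.proj (G p)
        (mfderiv 𝓘(ℝ, ℝ × EuclideanSpace ℝ (Fin (n - 1))) (𝓡∂ n) G p V) :
          EuclideanSpace ℝ (Fin (n - 1))) = chartFrame q (ζ p) (fderiv ℝ ζ p V) := by
    intro V
    have h1 := mfderiv_comp p hp1 hG
    have h2 : mfderiv 𝓘(ℝ, ℝ × EuclideanSpace ℝ (Fin (n - 1))) (𝓡 (n - 1)) (S.proj ∘ G) p =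
      mfderiv 𝓘(ℝ, ℝ × EuclideanSpace ℝ (Fin (n - 1))) (𝓡 (n - 1))
        ((extChartAt (𝓡 (n - 1)) q).symm ∘ ζ) p := EventuallyEq.mfderiv_eq hζ
    have h3 := mfderiv_comp p (mdifferentiableAt_chart_symm q hζt) hζd.mdifferentiableAt
    rw [mfderiv_eq_fderiv] at h3
    exact DFunLike.congr_fun ((h1.symm.trans h2).trans h3) V
  rw [S.metric_eq _ ⟨hGs, hGi⟩, hx1, hx1, hυ.eq_of_nhds]
  congr 2
  exact form_congr (h := S.h) rfl hζ.eq_of_nhds (hp V) (hp W)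

end Pullback

section Neighborhood

variable {E : Type*} [NormedAddCommGroup E]

lemma exists_box {P : ℝ × E → Prop} {y : E} (h : ∀ᶠ p in 𝓝[{p | 0 ≤ p.1}] ((0 : ℝ), y), P p) :
    ∃ ε > 0, ∃ B : Set E, IsOpen B ∧ y ∈ B ∧ ∀ p ∈ Ico 0 ε ×ˢ B, P p := by
  obtain ⟨r, hr, h⟩ := Metric.mem_nhdsWithin_iff.1 h
  refine ⟨r, hr, Metric.ball y r, Metric.isOpen_ball, Metric.mem_ball_self hr, fun p hp ↦ ?_⟩
  refine h ⟨?_, hp.1.1⟩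
  rw [← ball_prod_same]
  exact ⟨by simpa [abs_of_nonneg hp.1.1] using hp.1.2, hp.2⟩

end Neighborhood

end AsympHyp

/-! ### Constructing the coordinate change -/

namespace AsympHyp

open Filter

section Transition

lemma boundary_mem {n : ℕ} [NeZero n] {M : Type*} [TopologicalSpace M]
    [ChartedSpace (EuclideanHalfSpace n) M] {N : Type*} [TopologicalSpace N]
    [ChartedSpace (EuclideanSpace ℝ (Fin (n - 1))) N] {ι : N → M}
    (hι : IsBoundaryInclusion n ι) (q : N) : ι q ∈ (𝓡∂ n).boundary M :=
  hι.range_eq ▸ mem_range_self q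

variable {n : ℕ} [NeZero n] {M : Type*} [TopologicalSpace M]
  [ChartedSpace (EuclideanHalfSpace n) M] [IsManifold (𝓡∂ n) ∞ M]
  {N : Type*} [TopologicalSpace N] [ChartedSpace (EuclideanSpace ℝ (Fin (n - 1))) N]
  [IsManifold (𝓡 (n - 1)) ∞ N] {g : InteriorMetric n M} {ι : N → M} {x x' : M → ℝ}

namespace NormalForm

lemma zero_mem_domain (S : NormalForm g ι x) (hι : IsBoundaryInclusion n ι)
    (hx : IsDefiningFunction n x) (q : N) : ((0 : ℝ), q) ∈ S.domain := by
  have h := S.mapsTo _ (S.boundary_subset (boundary_mem hι q))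
  rwa [hx.zero _ (boundary_mem hι q), S.proj_boundary] at h

lemma collar_zero (S : NormalForm g ι x) (hι : IsBoundaryInclusion n ι)
    (hx : IsDefiningFunction n x) (q : N) : S.collar (0, q) = ι q := by
  have h := S.left_inv _ (S.boundary_subset (boundary_mem hι q))
  rwa [hx.zero _ (boundary_mem hι q), S.proj_boundary] at h

lemma nonneg_of_mem_domain (S : NormalForm g ι x) {p : ℝ × N} (hp : p ∈ S.domain) : 0 ≤ p.1 := by
  obtain ⟨O, _, h⟩ := S.domain_eq
  rw [h] at hp
  exact hp.2

/-- The collar in the preferred chart of the boundary at `q`. -/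
def chartCollar (S : NormalForm g ι x) (q : N) (p : ℝ × EuclideanSpace ℝ (Fin (n - 1))) : M :=
  S.collar (chartProd q p)

lemma eventually_mem_domain (S : NormalForm g ι x) (hι : IsBoundaryInclusion n ι)
    (hx : IsDefiningFunction n x) (q : N) :
    ∀ᶠ p in 𝓝[{p | 0 ≤ p.1}] ((0 : ℝ), extChartAt (𝓡 (n - 1)) q q),
      p.2 ∈ (extChartAt (𝓡 (n - 1)) q).target ∧ chartProd q p ∈ S.domain := by
  obtain ⟨O, hO, h⟩ := S.domain_eq
  have h0 := S.zero_mem_domain hι hx q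
  rw [h] at h0
  have h1 := (tendsto_chartProd (m := n - 1) q).eventually (hO.mem_nhds h0.1)
  have h2 : ∀ᶠ p in 𝓝 ((0 : ℝ), extChartAt (𝓡 (n - 1)) q q),
      p.2 ∈ (extChartAt (𝓡 (n - 1)) q).target :=
    ((isOpen_extChartAt_target q).preimage continuous_snd).mem_nhds (mem_extChartAt_target q)
  filter_upwards [nhdsWithin_le_nhds h1, nhdsWithin_le_nhds h2, self_mem_nhdsWithin] with p hp1 hp2 hp3
  refine ⟨hp2, ?_⟩
  rw [h]
  exact ⟨hp1, hp3⟩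

lemma tendsto_chartCollar (S : NormalForm g ι x) (hι : IsBoundaryInclusion n ι)
    (hx : IsDefiningFunction n x) (q : N) :
    Tendsto (S.chartCollar q) (𝓝[{p | 0 ≤ p.1}] ((0 : ℝ), extChartAt (𝓡 (n - 1)) q q))
      (𝓝 (ι q)) := by
  have h1 := (S.collar_smooth _ (S.zero_mem_domain hι hx q)).continuousWithinAt.tendsto
  rw [S.collar_zero hι hx] at h1
  refine h1.comp (tendsto_nhdsWithin_iff.2
    ⟨(tendsto_chartProd q).mono_left nhdsWithin_le_nhds, ?_⟩)
  filter_upwards [S.eventually_mem_domain hι hx q] with p hp using hp.2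

lemma contMDiffOn_chartCollar (S : NormalForm g ι x) (q : N)
    {s : Set (ℝ × EuclideanSpace ℝ (Fin (n - 1)))}
    (hs : ∀ p ∈ s, p.2 ∈ (extChartAt (𝓡 (n - 1)) q).target ∧ chartProd q p ∈ S.domain) :
    ContMDiffOn 𝓘(ℝ, ℝ × EuclideanSpace ℝ (Fin (n - 1))) (𝓡∂ n) ∞ (S.chartCollar q) s :=
  S.collar_smooth.comp ((contMDiffOn_chartProd q).mono fun p hp ↦ (hs p hp).1)
    fun p hp ↦ (hs p hp).2

/-- The first component of the coordinate change. -/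
def chartU (x : M → ℝ) (S' : NormalForm g ι x') (q : N)
    (p : ℝ × EuclideanSpace ℝ (Fin (n - 1))) : ℝ :=
  x (S'.chartCollar q p)

/-- The boundary components of the coordinate change. -/
def chartZ (S : NormalForm g ι x) (S' : NormalForm g ι x') (q : N)
    (p : ℝ × EuclideanSpace ℝ (Fin (n - 1))) : EuclideanSpace ℝ (Fin (n - 1)) :=
  extChartAt (𝓡 (n - 1)) q (S.proj (S'.chartCollar q p))

lemma exists_domain (hι : IsBoundaryInclusion n ι) (hx : IsDefiningFunction n x)
    (hx' : IsDefiningFunction n x') (S : NormalForm g ι x) (S' : NormalForm g ι x') (q : N)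
    {ε₁ : ℝ} (hε₁ : 0 < ε₁) {B₁ : Set (EuclideanSpace ℝ (Fin (n - 1)))} (hB₁ : IsOpen B₁)
    (hq : extChartAt (𝓡 (n - 1)) q q ∈ B₁) :
    ∃ ε > 0, ∃ B : Set (EuclideanSpace ℝ (Fin (n - 1))), IsOpen B ∧
      extChartAt (𝓡 (n - 1)) q q ∈ B ∧ ∀ p ∈ Ico 0 ε ×ˢ B,
        (p.2 ∈ (extChartAt (𝓡 (n - 1)) q).target ∧ chartProd q p ∈ S'.domain) ∧
        S'.chartCollar q p ∈ S.source ∧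
        S.proj (S'.chartCollar q p) ∈ (extChartAt (𝓡 (n - 1)) q).source ∧
        (chartU x S' q p, chartZ S S' q p) ∈ Ico 0 ε₁ ×ˢ B₁ := by
  have hG := S'.tendsto_chartCollar hι hx' q
  have hsrc := S.boundary_subset (boundary_mem hι q)
  have hproj : Tendsto S.proj (𝓝 (ι q)) (𝓝 q) := by
    have := (S.proj_smooth.contMDiffAt (S.isOpen_source.mem_nhds hsrc)).continuousAt.tendsto
    rwa [S.proj_boundary] at this
  have hxt : Tendsto x (𝓝 (ι q)) (𝓝 0) := by
    have := (hx.smooth.continuous.tendsto (ι q))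
    rwa [hx.zero _ (boundary_mem hι q)] at this
  have hφ : Tendsto (extChartAt (𝓡 (n - 1)) q) (𝓝 q) (𝓝 (extChartAt (𝓡 (n - 1)) q q)) :=
    (continuousAt_extChartAt q).tendsto
  have e1 := hG.eventually (S.isOpen_source.mem_nhds hsrc)
  have e2 := (hproj.comp hG).eventually ((isOpen_extChartAt_source (I := 𝓡 (n - 1)) q).mem_nhds
    (mem_extChartAt_source q))
  have e3 := (hxt.comp hG).eventually_lt_const hε₁
  have e4 := (hφ.comp (hproj.comp hG)).eventually (hB₁.mem_nhds hq)
  refine exists_box ?_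
  filter_upwards [S'.eventually_mem_domain hι hx' q, e1, e2, e3, e4] with p h0 h1 h2 h3 h4
  exact ⟨h0, h1, h2, ⟨S.nonneg_of_mem_domain (S.mapsTo _ h1), h3⟩, h4⟩

/-- Two normal forms of the same metric are related by a coordinate change near each boundary
point. -/
theorem exists_coordChange (hι : IsBoundaryInclusion n ι) (hx : IsDefiningFunction n x)
    (hx' : IsDefiningFunction n x') (S : NormalForm g ι x) (S' : NormalForm g ι x') (q : N) :
    ∃ (ε ε₁ : ℝ) (B B₁ : Set (EuclideanSpace ℝ (Fin (n - 1)))),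
      extChartAt (𝓡 (n - 1)) q q ∈ B ∧ B₁ ⊆ (extChartAt (𝓡 (n - 1)) q).target ∧
      CoordChange ε ε₁ B B₁ (chartU x S' q) (chartZ S S' q) (metricCoord S.h q)
        (metricCoord S'.h q) := by
  obtain ⟨ε₁, hε₁, B₁, hB₁, hq₁, hbox₁⟩ := exists_box (S.eventually_mem_domain hι hx q)
  obtain ⟨ε, hε, B, hB, hq, hbox⟩ := exists_domain hι hx hx' S S' q hε₁ hB₁ hq₁
  have hB₁t : B₁ ⊆ (extChartAt (𝓡 (n - 1)) q).target := fun w hw ↦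
    (hbox₁ (0, w) ⟨⟨le_rfl, hε₁⟩, hw⟩).1
  have hG := S'.contMDiffOn_chartCollar q fun p hp ↦ (hbox p hp).1
  have hu : ContDiffOn ℝ ∞ (chartU x S' q) (Ico 0 ε ×ˢ B) := by
    rw [← contMDiffOn_iff_contDiffOn]
    exact hx.smooth.comp_contMDiffOn hG
  have hz : ContDiffOn ℝ ∞ (chartZ S S' q) (Ico 0 ε ×ˢ B) := by
    rw [← contMDiffOn_iff_contDiffOn]
    refine (contMDiffOn_extChartAt (I := 𝓡 (n - 1)) (x := q)).comp
      (S.proj_smooth.comp hG fun p hp ↦ (hbox p hp).2.1) fun p hp ↦ ?_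
    have := (hbox p hp).2.2.1
    rwa [extChartAt_source] at this
  have hx'G : ∀ p ∈ Ico 0 ε ×ˢ B, x' (S'.chartCollar q p) = p.1 := fun p hp ↦
    congrArg Prod.fst (S'.right_inv _ (hbox p hp).1.2)
  have hp'G : ∀ p ∈ Ico 0 ε ×ˢ B, S'.proj (S'.chartCollar q p) =
      (extChartAt (𝓡 (n - 1)) q).symm p.2 := fun p hp ↦
    congrArg Prod.snd (S'.right_inv _ (hbox p hp).1.2)
  have hint : ∀ p ∈ Ico 0 ε ×ˢ B, 0 < p.1 → S'.chartCollar q p ∈ (𝓡∂ n).interior M := by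
    intro p hp h0
    refine ((𝓡∂ n).isInteriorPoint_or_isBoundaryPoint _).resolve_right fun hb ↦ h0.ne' ?_
    rw [← hx'G p hp]
    exact hx'.zero _ hb
  have hG0 : ∀ w ∈ B, S'.chartCollar q (0, w) = ι ((extChartAt (𝓡 (n - 1)) q).symm w) :=
    fun w _ ↦ S'.collar_zero hι hx' _
  have hmem0 : ∀ w ∈ B, ((0 : ℝ), w) ∈ Ico 0 ε ×ˢ B := fun w hw ↦ ⟨⟨le_rfl, hε⟩, hw⟩
  have hupos : ∀ p ∈ Ico 0 ε ×ˢ B, 0 < p.1 → 0 < chartU x S' q p := fun p hp h0 ↦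
    hx.pos _ (hint p hp h0)
  -- The metric is pulled back along the collar of `S'` twice: through `S`, with coordinate
  -- functions `u` and `z`, and through `S'`, where they are the two projections. Special choices of
  -- `V` and `W` give the three component identities.
  have key : ∀ p ∈ Ico 0 ε ×ˢ B, 0 < p.1 → ∀ V W : ℝ × EuclideanSpace ℝ (Fin (n - 1)),
      chartU x S' q p ^ 2 * (V.1 * W.1 +
        ∑ a, ∑ b, V.2 a * metricCoord S'.h q a b p * W.2 b) =
      p.1 ^ 2 * (dirDeriv (Ico 0 ε ×ˢ B) V (chartU x S' q) p *
          dirDeriv (Ico 0 ε ×ˢ B) W (chartU x S' q) p +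
        ∑ a, ∑ b, dirDeriv (Ico 0 ε ×ˢ B) V (fun p ↦ chartZ S S' q p a) p *
          metricCoord S.h q a b (chartU x S' q p, chartZ S S' q p) *
          dirDeriv (Ico 0 ε ×ˢ B) W (fun p ↦ chartZ S S' q p b) p) := by
    intro p hp h0 V W
    have hnhds : Ico 0 ε ×ˢ B ∈ 𝓝 p :=
      prod_mem_nhds (Ico_mem_nhds h0 hp.1.2) (hB.mem_nhds hp.2)
    have hGd : MDifferentiableAt 𝓘(ℝ, ℝ × EuclideanSpace ℝ (Fin (n - 1))) (𝓡∂ n)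
      (S'.chartCollar q) p := (hG.contMDiffAt hnhds).mdifferentiableAt (by simp)
    have hzd : DifferentiableAt ℝ (chartZ S S' q) p :=
      (hz.contDiffAt hnhds).differentiableAt (by simp)
    have hzt : chartZ S S' q p ∈ (extChartAt (𝓡 (n - 1)) q).target :=
      hB₁t (hbox p hp).2.2.2.2
    have e1 := S.metric_pullback hx.smooth hGd (hbox p hp).2.1 (hint p hp h0)
      (υ := chartU x S' q) EventuallyEq.rfl hzd q hzt (by
        filter_upwards [hnhds] with r hr
        exact ((extChartAt (𝓡 (n - 1)) q).left_inv (hbox r hr).2.2.1).symm) V W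
    have e2 := S'.metric_pullback hx'.smooth hGd (S'.mapsTo_collar _ (hbox p hp).1.2)
      (hint p hp h0) (υ := Prod.fst) (by
        filter_upwards [hnhds] with r hr using hx'G r hr) (ζ := Prod.snd)
      differentiableAt_snd q (hbox p hp).1.1 (by
        filter_upwards [hnhds] with r hr using hp'G r hr) V W
    rw [e1, form_frame_expand, form_frame_expand, fderiv_fst, fderiv_snd] at e2
    have hzc : ∀ (V : ℝ × EuclideanSpace ℝ (Fin (n - 1))) (a : Fin (n - 1)),
        dirDeriv (Ico 0 ε ×ˢ B) V (fun p ↦ chartZ S S' q p a) p =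
          (fderiv ℝ (chartZ S S' q) p V) a := by
      intro V a
      rw [dirDeriv, fderivWithin_of_mem_nhds hnhds]
      have := ((EuclideanSpace.proj a : EuclideanSpace ℝ (Fin (n - 1)) →L[ℝ] ℝ).hasFDerivAt.comp p
        hzd.hasFDerivAt).fderiv
      exact DFunLike.congr_fun this V
    have huc : ∀ V : ℝ × EuclideanSpace ℝ (Fin (n - 1)),
        dirDeriv (Ico 0 ε ×ˢ B) V (chartU x S' q) p = fderiv ℝ (chartU x S' q) p V := fun V ↦ by
      rw [dirDeriv, fderivWithin_of_mem_nhds hnhds]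
    simp only [hzc, huc]
    have hu0 := (hupos p hp h0).ne'
    have ht0 := h0.ne'
    simp only [ContinuousLinearMap.coe_fst', ContinuousLinearMap.coe_snd'] at e2
    field_simp at e2
    linear_combination -e2
  refine ⟨ε, ε₁, B, B₁, hq, hB₁t, ?_⟩
  exact
    { pos := hε
      pos₁ := hε₁
      isOpen := hB
      isOpen₁ := hB₁
      u_smooth := hu
      z_smooth := hz
      h_smooth := fun a b ↦ contDiffOn_metricCoord S.h_smooth q a b hbox₁
      h'_smooth := fun a b ↦ contDiffOn_metricCoord S'.h_smooth q a b fun p hp ↦ (hbox p hp).1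
      mapsTo := fun p hp ↦ (hbox p hp).2.2.2
      u_zero := fun w hw ↦ by
        rw [chartU, hG0 w hw]
        exact hx.zero _ (boundary_mem hι _)
      u_pos := hupos
      z_zero := fun w hw ↦ by
        rw [chartZ, hG0 w hw, S.proj_boundary]
        exact (extChartAt (𝓡 (n - 1)) q).right_inv (hbox _ (hmem0 w hw)).1.1
      -- A null vector `c` satisfies `h₀(c, c) = 0`; positivity and injectivity of the frame then
      -- give `c = 0`.
      nondegenerate := fun w hw c hc ↦ by
        have ht := (hbox _ (hmem0 w hw)).1.1
        have h1 := form_frame_expand S.h q 0 w (WithLp.toLp 2 c) (WithLp.toLp 2 c)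
        rw [Finset.sum_comm] at h1
        simp only [← Finset.sum_mul, hc, zero_mul, Finset.sum_const_zero] at h1
        by_contra hne
        refine (S.h_pos _ (S.zero_mem_domain hι hx _)
          (chartFrame q w (WithLp.toLp 2 c)) fun h2 ↦ hne ?_).ne' h1
        have := (isInvertible_chartFrame q ht).injective (h2.trans (map_zero _).symm)
        simpa using this
      normal_normal := fun p hp h0 ↦ by
        simpa [pow_two] using key p hp h0 (1, 0) (1, 0)
      normal_tangential := fun p hp h0 i ↦ by
        have h1 := key p hp h0 (1, 0) (0, EuclideanSpace.single i 1)
        have h2 := h0.ne'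
        refine Eq.symm ?_
        simpa [h2] using h1
      tangential_tangential := fun p hp h0 i j ↦ by
        have h1 := key p hp h0 (0, EuclideanSpace.single i 1) (0, EuclideanSpace.single j 1)
        rw [← h1]
        simp }

end NormalForm

end Transition

end AsympHyp

/-! ### Transformation of the expansion and of the trace -/

namespace AsympHyp

open Filter

section Expansion

variable {n : ℕ} [NeZero n] {M : Type*} [TopologicalSpace M]
  [ChartedSpace (EuclideanHalfSpace n) M] [IsManifold (𝓡∂ n) ∞ M]
  {N : Type*} [TopologicalSpace N] [ChartedSpace (EuclideanSpace ℝ (Fin (n - 1))) N]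
  [IsManifold (𝓡 (n - 1)) ∞ N] {g : InteriorMetric n M} {ι : N → M} {x x' : M → ℝ}

namespace NormalForm

/-- Existence of the partially even expansion of `S'` at a boundary point, and the transformation
rules of its coefficients of orders `0` and `n`. -/
theorem exists_expansion_at (hn : Odd n) [Nonempty (Fin (n - 1))]
    (hι : IsBoundaryInclusion n ι) (hx : IsDefiningFunction n x)
    (hx' : IsDefiningFunction n x') (S : NormalForm g ι x) (S' : NormalForm g ι x')
    {κ : ∀ q : N, TangentSpace (𝓡 (n - 1)) q →L[ℝ] TangentSpace (𝓡 (n - 1)) q →L[ℝ] ℝ}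
    (hκ : S.HasPartiallyEvenExpansion κ) (q : N) :
    ∃ c' : ℕ → (TangentSpace (𝓡 (n - 1)) q →L[ℝ] TangentSpace (𝓡 (n - 1)) q →L[ℝ] ℝ),
      (∀ k, Odd k → k < n → c' k = 0) ∧
      (∀ v w : TangentSpace (𝓡 (n - 1)) q,
        ExpTo (n + 1) (fun t ↦ S'.h t q v w) (PowerSeries.mk fun k ↦ c' k v w)) ∧
      ∃ α : ℝ, 0 < α ∧ ∀ v w : TangentSpace (𝓡 (n - 1)) q,
        α ^ 2 * S'.h 0 q v w = S.h 0 q v w ∧ α ^ 2 * (n * c' n v w) = α ^ n * κ q v w := by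
  obtain ⟨c, hc0, hcκ, hcexp⟩ := hκ
  obtain ⟨ε, ε₁, B, B₁, hq, hB₁t, A⟩ := exists_coordChange hι hx hx' S S' q
  have hcoeff : ∀ a b, ∀ w ∈ B₁, ∀ j < n + 1,
      PowerSeries.coeff j (jet (Ico 0 ε₁ ×ˢ B₁) (metricCoord S.h q a b) w) =
        metricCoord (fun _ ↦ c j) q a b (0, w) := by
    intro a b w hw j hj
    have h1 : ExpTo (n + 1) (fun t ↦ metricCoord S.h q a b (t, w))
        (PowerSeries.mk fun j ↦ metricCoord (fun _ ↦ c j) q a b (0, w)) := by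
      simp only [ExpTo, PowerSeries.coeff_mk]
      exact hcexp ((extChartAt (𝓡 (n - 1)) q).symm w) (chartFrame q w (EuclideanSpace.single a 1))
        (chartFrame q w (EuclideanSpace.single b 1))
    rw [(expTo_jet A.pos₁ A.isOpen₁ (A.h_smooth a b) hw (n + 1)).unique h1 j hj,
      PowerSeries.coeff_mk]
  have heven : ∀ a b, ∀ w ∈ B₁,
      IsEvenMod n (jet (Ico 0 ε₁ ×ˢ B₁) (metricCoord S.h q a b) w) := by
    intro a b w hw j hj ho
    -- Both `j` and `n` are odd, so `j < n` already means `j ≤ n - 2`.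
    have h1 : j + 1 < n := by
      obtain ⟨r, rfl⟩ := hn
      obtain ⟨s, rfl⟩ := ho
      omega
    rw [hcoeff a b w hw j (by omega), metricCoord, hc0 j ho h1]
    rfl
  obtain ⟨α, hα, hloc⟩ := A.coeff_transform hn heven hq
  set y := extChartAt (𝓡 (n - 1)) q q with hy
  have hyt : y ∈ (extChartAt (𝓡 (n - 1)) q).target := mem_extChartAt_target q
  have hqy : (extChartAt (𝓡 (n - 1)) q).symm y = q := extChartAt_to_inv q
  -- The base point is generalized so that `q` can be replaced by `φ⁻¹ (φ q)`, where the frame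
  -- lives.
  suffices h : ∀ r, r = (extChartAt (𝓡 (n - 1)) q).symm y →
      ∃ c' : ℕ → (TangentSpace (𝓡 (n - 1)) r →L[ℝ] TangentSpace (𝓡 (n - 1)) r →L[ℝ] ℝ),
      (∀ k, Odd k → k < n → c' k = 0) ∧
      (∀ v w : TangentSpace (𝓡 (n - 1)) r,
        ExpTo (n + 1) (fun t ↦ S'.h t r v w) (PowerSeries.mk fun k ↦ c' k v w)) ∧
      ∃ α : ℝ, 0 < α ∧ ∀ v w : TangentSpace (𝓡 (n - 1)) r,
        α ^ 2 * S'.h 0 r v w = S.h 0 r v w ∧ α ^ 2 * (n * c' n v w) = α ^ n * κ r v w from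
    h q hqy.symm
  rintro r rfl
  obtain ⟨e, he⟩ := isInvertible_chartFrame q hyt
  have hL : ∀ v, chartFrame q y (e.symm v) = v := fun v ↦ by
    rw [← he]; exact e.apply_symm_apply v
  have hexpand : ∀ (h : ℝ → ∀ q : N,
      TangentSpace (𝓡 (n - 1)) q →L[ℝ] TangentSpace (𝓡 (n - 1)) q →L[ℝ] ℝ) (t : ℝ)
      (v w : TangentSpace (𝓡 (n - 1)) ((extChartAt (𝓡 (n - 1)) q).symm y)),
      h t ((extChartAt (𝓡 (n - 1)) q).symm y) v w =
        ∑ a, ∑ b, e.symm v a * metricCoord h q a b (t, y) * e.symm w b := by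
    intro h t v w
    have := form_frame_expand h q t y (e.symm v) (e.symm w)
    rwa [hL, hL] at this
  -- The bilinear forms whose components in the chart frame are the Taylor coefficients of those of
  -- `S'.h`.
  set c' : ℕ → (TangentSpace (𝓡 (n - 1)) ((extChartAt (𝓡 (n - 1)) q).symm y) →L[ℝ]
      TangentSpace (𝓡 (n - 1)) ((extChartAt (𝓡 (n - 1)) q).symm y) →L[ℝ] ℝ) := fun k ↦
    ∑ a, ∑ b, PowerSeries.coeff k (jet (Ico 0 ε ×ˢ B) (metricCoord S'.h q a b) y) •
      (((EuclideanSpace.proj a : EuclideanSpace ℝ (Fin (n - 1)) →L[ℝ] ℝ).comp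
        (e.symm : _ →L[ℝ] EuclideanSpace ℝ (Fin (n - 1)))).smulRight
        ((EuclideanSpace.proj b : EuclideanSpace ℝ (Fin (n - 1)) →L[ℝ] ℝ).comp
        (e.symm : _ →L[ℝ] EuclideanSpace ℝ (Fin (n - 1))))) with hc'
  have hc'app : ∀ k v w, c' k v w = ∑ a, ∑ b, e.symm v a *
      PowerSeries.coeff k (jet (Ico 0 ε ×ˢ B) (metricCoord S'.h q a b) y) * e.symm w b := by
    intro k v w
    simp only [hc', sum_apply, smul_apply, ContinuousLinearMap.smulRight_apply,
      ContinuousLinearMap.comp_apply, ContinuousLinearEquiv.coe_coe, PiLp.proj_apply,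
      smul_eq_mul]
    exact Finset.sum_congr rfl fun a _ ↦ Finset.sum_congr rfl fun b _ ↦ by ring
  refine ⟨c', fun k hk hkn ↦ ?_, fun v w ↦ ?_, α, hα, fun v w ↦ ⟨?_, ?_⟩⟩
  · refine ContinuousLinearMap.ext fun v ↦ ContinuousLinearMap.ext fun w ↦ (hc'app k v w).trans ?_
    refine Finset.sum_eq_zero fun a _ ↦ Finset.sum_eq_zero fun b _ ↦ ?_
    rw [(hloc a b).1 k hkn hk, mul_zero, zero_mul]
  · have h1 : ExpTo (n + 1) (fun t ↦ ∑ a, ∑ b, (e.symm v a * e.symm w b) *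
        metricCoord S'.h q a b (t, y)) (∑ a, ∑ b, PowerSeries.C (e.symm v a * e.symm w b) *
          jet (Ico 0 ε ×ˢ B) (metricCoord S'.h q a b) y) :=
      ExpTo.sum _ fun a _ ↦ ExpTo.sum _ fun b _ ↦
        ExpTo.const_mul _ (A.expTo hq (A.h'_smooth a b) (n + 1))
    refine (h1.congr_fun (Eventually.of_forall fun t ↦ ?_)).congr_coeff fun j _ ↦ ?_
    · simp only [hexpand S'.h t v w]
      exact Finset.sum_congr rfl fun a _ ↦ Finset.sum_congr rfl fun b _ ↦ by ring
    · simp only [PowerSeries.coeff_mk, hc'app, map_sum, PowerSeries.coeff_C_mul]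
      exact Finset.sum_congr rfl fun a _ ↦ Finset.sum_congr rfl fun b _ ↦ by ring
  · rw [hexpand S'.h 0 v w, hexpand S.h 0 v w, Finset.mul_sum]
    refine Finset.sum_congr rfl fun a _ ↦ ?_
    rw [Finset.mul_sum]
    refine Finset.sum_congr rfl fun b _ ↦ ?_
    rw [← (hloc a b).2.1]
    ring
  · rw [hcκ, smul_apply, smul_apply, hexpand (fun _ ↦ c n) 0 v w, hc'app, smul_eq_mul]
    simp only [Finset.mul_sum]
    refine Finset.sum_congr rfl fun a _ ↦ Finset.sum_congr rfl fun b _ ↦ ?_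
    rw [← hcoeff a b y (A.mem_B₁ hq) n (Nat.lt_succ_self n)]
    linear_combination (n : ℝ) * e.symm v a * e.symm w b * (hloc a b).2.2

end NormalForm

lemma metricTrace_smul {m : ℕ} {N : Type*} [TopologicalSpace N]
    [ChartedSpace (EuclideanSpace ℝ (Fin m)) N] {q : N}
    {B B' K K' : TangentSpace (𝓡 m) q →L[ℝ] TangentSpace (𝓡 m) q →L[ℝ] ℝ} {r s : ℝ}
    (hr : r ≠ 0) (hB : ∀ v w, B' v w = r * B v w) (hK : ∀ v w, K' v w = s * K v w) :
    metricTrace B' K' = r⁻¹ * s * metricTrace B K := by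
  have hinv : ∀ P : Matrix (Fin m) (Fin m) ℝ, (r • P)⁻¹ = r⁻¹ • P⁻¹ := by
    intro P
    -- For singular `P` both inverses are 0 by convention, so no nondegeneracy of `B` is needed.
    by_cases hP : IsUnit P.det
    · exact Matrix.inv_smul' P (Units.mk0 r hr) hP
    · have hP' : ¬ IsUnit (r • P).det := by
        rw [Matrix.det_smul, IsUnit.mul_iff]
        exact fun h ↦ hP h.2
      rw [Matrix.nonsing_inv_apply_not_isUnit _ hP, Matrix.nonsing_inv_apply_not_isUnit _ hP',
        smul_zero]
  have h1 : (Matrix.of fun i j : Fin m ↦ B' (EuclideanSpace.single i (1 : ℝ) :)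
      (EuclideanSpace.single j (1 : ℝ) :)) = r • Matrix.of fun i j : Fin m ↦
        B (EuclideanSpace.single i (1 : ℝ) :) (EuclideanSpace.single j (1 : ℝ) :) := by
    ext i j
    simp only [Matrix.of_apply, Matrix.smul_apply, smul_eq_mul]
    exact hB _ _
  have h2 : (Matrix.of fun i j : Fin m ↦ K' (EuclideanSpace.single i (1 : ℝ) :)
      (EuclideanSpace.single j (1 : ℝ) :)) = s • Matrix.of fun i j : Fin m ↦
        K (EuclideanSpace.single i (1 : ℝ) :) (EuclideanSpace.single j (1 : ℝ) :) := by
    ext i j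
    simp only [Matrix.of_apply, Matrix.smul_apply, smul_eq_mul]
    exact hK _ _
  simp only [metricTrace]
  rw [h1, h2, hinv, Matrix.smul_mul, Matrix.mul_smul, Matrix.trace_smul, Matrix.trace_smul,
    smul_eq_mul, smul_eq_mul, mul_assoc]

end Expansion

end AsympHyp

end

theorem proposition2p6 {n : ℕ} [NeZero n] (hn : Odd n)
    {M : Type*} [TopologicalSpace M] [T2Space M] [SecondCountableTopology M]
    [ChartedSpace (EuclideanHalfSpace n) M] [IsManifold (𝓡∂ n) ∞ M]
    {N : Type*} [TopologicalSpace N] [ChartedSpace (EuclideanSpace ℝ (Fin (n - 1))) N]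
    [IsManifold (𝓡 (n - 1)) ∞ N]
    {ι : N → M} (hι : AsympHyp.IsBoundaryInclusion n ι)
    {g : AsympHyp.InteriorMetric n M} {x x' : M → ℝ}
    (hx : AsympHyp.IsSpecialDefiningFunction g x)
    (hx' : AsympHyp.IsSpecialDefiningFunction g x')
    (S : AsympHyp.NormalForm g ι x) (S' : AsympHyp.NormalForm g ι x')
    (hS : S.IsPartiallyEven) :
    S'.IsPartiallyEven ∧
    ∀ ω₀ : N → ℝ, (∀ q, S'.h 0 q = Real.exp (2 * ω₀ q) • S.h 0 q) →
      ∀ κ κ', S.HasPartiallyEvenExpansion κ → S'.HasPartiallyEvenExpansion κ' →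
        ∀ q, S'.massAspect κ' q = Real.exp (-(n : ℝ) * ω₀ q) * S.massAspect κ q := by
  -- When `n = 1` the boundary has dimension 0, all tangent spaces are trivial and both traces are
  -- empty sums.
  rcases isEmpty_or_nonempty (Fin (n - 1)) with hempty | hne
  · have hsub : ∀ (q : N) (v : TangentSpace (𝓡 (n - 1)) q), v = 0 := fun q v ↦ by
      refine WithLp.ofLp_injective 2 (funext fun i ↦ (hempty.false i).elim)
    refine ⟨⟨0, 0, fun _ _ _ _ ↦ rfl, fun q ↦ ?_, fun q v w ↦ ?_⟩,
      fun ω₀ _ κ κ' _ _ q ↦ ?_⟩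
    · refine ContinuousLinearMap.ext fun v ↦ ?_
      rw [hsub q v, map_zero, map_zero]
    · refine IsBigO.congr_left (isBigO_zero _ _) fun t ↦ ?_
      rw [hsub q v]
      simp
    · simp [AsympHyp.NormalForm.massAspect, AsympHyp.metricTrace, Matrix.trace]
  · have hd := hx.isDefiningFunction
    have hd' := hx'.isDefiningFunction
    refine ⟨?_, fun ω₀ hω κ κ' hκ hκ' q ↦ ?_⟩
    · obtain ⟨κ, hκ⟩ := hS
      choose c' h0 hexp _ using AsympHyp.NormalForm.exists_expansion_at hn hι hd hd' S S' hκ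
      refine ⟨fun q ↦ (n : ℝ) • c' q n, fun k q ↦ c' q k, fun k hk hkn q ↦ h0 q k hk (by omega),
        fun q ↦ rfl, fun q v w ↦ ?_⟩
      simpa only [AsympHyp.ExpTo, PowerSeries.coeff_mk] using hexp q v w
    · obtain ⟨c', -, hexp, α, hα, htr⟩ :=
        AsympHyp.NormalForm.exists_expansion_at hn hι hd hd' S S' hκ q
      obtain ⟨c'', -, hκ'', hexp''⟩ := hκ'
      -- `κ'` comes from an arbitrary expansion of `S'.h`; uniqueness of coefficients ties it to the
      -- constructed one.
      have hcc : ∀ v w : TangentSpace (𝓡 (n - 1)) q, κ' q v w = n * c' n v w := by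
        intro v w
        have h1 : AsympHyp.ExpTo (n + 1) (fun t ↦ S'.h t q v w)
            (PowerSeries.mk fun k ↦ c'' k q v w) := by
          simpa only [AsympHyp.ExpTo, PowerSeries.coeff_mk] using hexp'' q v w
        have h2 := h1.unique (hexp v w) n (Nat.lt_succ_self n)
        rw [PowerSeries.coeff_mk, PowerSeries.coeff_mk] at h2
        rw [hκ'', smul_apply, smul_apply, h2, smul_eq_mul]
      -- Comparing `α² h'₀ = h₀` with `h'₀ = e^{2ω₀} h₀` on one nonzero vector gives `(α e^{ω₀})² =
      -- 1`, and positivity selects the root.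
      have hαω : α = Real.exp (-ω₀ q) := by
        obtain ⟨i⟩ := hne
        set v : TangentSpace (𝓡 (n - 1)) q :=
          (EuclideanSpace.single i (1 : ℝ) : EuclideanSpace ℝ (Fin (n - 1))) with hv
        have hv0 : v ≠ 0 := by
          intro h
          have h1 : (EuclideanSpace.single i (1 : ℝ) : EuclideanSpace ℝ (Fin (n - 1))) = 0 := h
          have := congrArg (fun u : EuclideanSpace ℝ (Fin (n - 1)) ↦ u i) h1
          simp at this
        have hpos : 0 < S.h 0 q v v := S.h_pos (0, q) (S.zero_mem_domain hι hd q) v hv0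
        have h1 := (htr v v).1
        rw [hω, smul_apply, smul_apply, smul_eq_mul, ← mul_assoc] at h1
        have h2 : α ^ 2 * Real.exp (2 * ω₀ q) = 1 := mul_right_cancel₀ hpos.ne' (by rw [h1, one_mul])
        have h3 : (α * Real.exp (ω₀ q)) ^ 2 = 1 := by
          rw [mul_pow, ← Real.exp_nat_mul]
          exact_mod_cast h2
        have h4 : α * Real.exp (ω₀ q) = 1 :=
          (pow_eq_one_iff_of_nonneg (by positivity) two_ne_zero).1 h3
        rw [Real.exp_neg]
        exact eq_inv_of_mul_eq_one_left h4
      have hK : ∀ v w : TangentSpace (𝓡 (n - 1)) q,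
          κ' q v w = (Real.exp (2 * ω₀ q) * α ^ n) * κ q v w := by
        intro v w
        have h1 := (htr v w).2
        rw [← hcc] at h1
        have h2 : α ^ 2 * Real.exp (2 * ω₀ q) = 1 := by
          rw [hαω, ← Real.exp_nat_mul, ← Real.exp_add]
          simp
        linear_combination Real.exp (2 * ω₀ q) * h1 - κ' q v w * h2
      have hB : ∀ v w : TangentSpace (𝓡 (n - 1)) q,
          S'.h 0 q v w = Real.exp (2 * ω₀ q) * S.h 0 q v w := fun v w ↦ by
        rw [hω]; rfl
      rw [AsympHyp.NormalForm.massAspect, AsympHyp.NormalForm.massAspect,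
        AsympHyp.metricTrace_smul (Real.exp_ne_zero _) hB hK, ← mul_assoc,
        inv_mul_cancel₀ (Real.exp_ne_zero _), one_mul, hαω, ← Real.exp_nat_mul]
      congr 2
      ring
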